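/- **Setting.** Let $\Bbbk$ be a field, $\mathsf G,\mathsf Z$ commutative groups (written additively), and $\mathsf X\subset\mathsf G$ a subset that is symmetric ($\mathsf X=-\mathsf X$) and small (no finite union of translates $g_i+\mathsf X$ equals $\mathsf G$). Let $\mathcal C$ be a $\Bbbk$-linear ribbon category: hom-sets are $\Bbbk$-vector spaces, composition and $\otimes$ are bilinear, $\Bbbk\to\mathrm{End}(\mathbb 1)$ is an isomorphism. Write $c$ for the braiding, $\theta$ for the twist, $\overrightarrow{\mathrm{ev}}_V:V^*\otimes V\to\mathbb 1$, $\overrightarrow{\mathrm{coev}}_V:\mathbb 1\to V\otimes V^*$ for the duality and $\overleftarrow{\mathrm{ev}}_V=\overrightarrow{\mathrm{ev}}_V\circ c_{V,V^*}\circ(\theta_V\otimes\mathrm{Id}):V\otimes V^*\to\mathbb 1$. For $f\in\mathrm{End}(U\otimes V)$ let $\mathrm{ptr}_V(f)=(\mathrm{Id}_U\otimes\overleftarrow{\mathrm{ev}}_V)(f\otimes\mathrm{Id}_{V^*})(\mathrm{Id}_U\otimes\overrightarrow{\mathrm{coev}}_V)\in\mathrm{End}(U)$. An object $V$ is simple if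 $\mathrm{Id}_V\ne0$ and $\mathrm{End}(V)=\Bbbk\,\mathrm{Id}_V$, and regular if its evaluation is an epimorphism. Suppose $\mathcal C$ is a *pre-modular $\mathsf G$-category relative to $(\mathsf Z,\mathsf X)$*, i.e. it is equipped with: - a $\mathsf G$-grading $\mathcal C\simeq\bigoplus_{g\in\mathsf G}\mathcal C_g$ by full subcategories, with $\mathbb 1\in\mathcal C_0$, $(\mathcal C_g)^*\subset\mathcal C_{-g}$, $\mathcal C_g\otimes\mathcal C_{h}\subset\mathcal C_{g+h}$, and no nonzero morphisms between objects of different degrees; every $\mathcal C_g$ contains an object with nonzero identity; - a free realisation of $\mathsf Z$ in $\mathcal C_0$: objects $\sigma(k)\in\mathcal C_0$ ($k\in\mathsf Z$) with $\sigma(0)\cong\mathbb 1$, $\sigma(j)\otimes\sigma(k)\cong\sigma(j+k)$, quantum dimension $\pm1$, $\theta_{\sigma(k)}=\mathrm{Id}$, and, for every simple $V$, $V\otimes\sigma(k)\cong V$ if and only if $k=0$; - a nonzero m-trace on the ideal of projective objects, i.e. linear maps $\mathsf t_V:\mathrm{End}(V)\to\Bbbk$ for $V$ projective, not all zero, with $\mathsf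 t_V(fg)=\mathsf t_U(gf)$ for $f:U\to V$, $g:V\to U$ and $\mathsf t_{U\otimes V}(f)=\mathsf t_U(\mathrm{ptr}_V f)$ for $U$ projective and any $V$; put $\mathsf d(V)=\mathsf t_V(\mathrm{Id}_V)$; - for every $g\in\mathsf G\setminus\mathsf X$, a finite family $(V_i)_{i\in I_g}$ of regular simple objects of $\mathcal C_g$ such that the family $(V_i\otimes\sigma(k))_{(i,k)\in I_g\times\mathsf Z}$ is dominating for $\mathcal C_g$ (every identity $\mathrm{Id}_V$, $V\in\mathcal C_g$, is a finite sum of morphisms factoring through members of the family) and completely reduced (the space of morphisms between two members has dimension $1$ if their indices agree and $0$ otherwise); and suppose there is a bilinear map $\psi:\mathsf G\times\mathsf Z\to\Bbbk^*$ with $c_{\sigma(k),V}\circ c_{V,\sigma(k)}=\psi(g,k)\,\mathrm{Id}_{V\otimes\sigma(k)}$ for all $g\in\mathsf G$, $V\in\mathcal C_g$, $k\in\mathsf Z$. For objects $U,V$ let $D_{V,U}=c_{U,V}\circ c_{V,U}\in\mathrm{Aut}(V\otimes U)$ and $\Phi_{U,V}=\mathrm{ptr}_U(D_{V,U})\in\mathrm{End}(V)$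 (a $U$-coloured circle around a $V$-coloured strand). Call $\zeta\in\Bbbk^*$ a *modularity parameter* if for all $g,h\in\mathsf G\setminus\mathsf X$ and $i,j\in I_g$ $$\mathsf d(V_i)\sum_{k\in I_h}\mathsf d(V_k)\,\Phi_{V_k,\,V_i\otimes V_j^*}=\delta_{i,j}\,\zeta\;\overrightarrow{\mathrm{coev}}_{V_i}\circ\overleftarrow{\mathrm{ev}}_{V_i};$$ $\mathcal C$ is *relative modular* if a modularity parameter exists. **Corollary.** Let $\mathcal C$ be relative modular with modularity parameter $\zeta_\Omega$. Then there are unique scalars $\Delta_+,\Delta_-\in\Bbbk$ such that for all $g\in\mathsf G\setminus\mathsf X$ and all $V\in\mathcal C_g$ $$\theta_V^{-1}\circ\sum_{i\in I_g}\mathsf d(V_i)\,\mathrm{ptr}_{V_i}\big((\mathrm{Id}_V\otimes\theta_{V_i}^{-1})D_{V,V_i}\big)=\Delta_-\,\mathrm{Id}_V,\qquad \theta_V\circ\sum_{i\in I_g}\mathsf d(V_i)\,\mathrm{ptr}_{V_i}\big((\mathrm{Id}_V\otimes\theta_{V_i})D_{V,V_i}^{-1}\big)=\Delta_+\,\mathrm{Id}_V,$$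 and $\zeta_\Omega=\Delta_+\Delta_-$. -/

import Mathlib

open CategoryTheory MonoidalCategory

namespace RelMod

universe v u

/-- A ribbon category: a braided category with duals, `η_ X Xᘁ : 𝟙 ⟶ X ⊗ Xᘁ` and
`ε_ X Xᘁ : Xᘁ ⊗ X ⟶ 𝟙`, and a natural twist `θ` that is compatible with the tensor product
and with the duality. -/
class RibbonCategory (C : Type u) [Category.{v} C] [MonoidalCategory C] [BraidedCategory C]
    [RightRigidCategory C] where
  twist : ∀ X : C, X ≅ X
  twist_naturality : ∀ {X Y : C} (f : X ⟶ Y), f ≫ (twist Y).hom = (twist X).hom ≫ f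
  twist_tensor : ∀ X Y : C, (twist (X ⊗ Y)).hom =
    ((twist X).hom ⊗ₘ (twist Y).hom) ≫ (β_ X Y).hom ≫ (β_ Y X).hom
  twist_dual : ∀ X : C, (twist (Xᘁ)).hom = rightAdjointMate (twist X).hom

section Ribbon

variable {C : Type u} [Category.{v} C] [MonoidalCategory C] [BraidedCategory C]
  [RightRigidCategory C] [RibbonCategory C]

/-- The twist `θ_X`. -/
abbrev twist (X : C) : X ≅ X := RibbonCategory.twist X

/-- The right-pointing coevaluation `𝟙 ⟶ V ⊗ V*`. -/
def coevR (V : C) : 𝟙_ C ⟶ V ⊗ Vᘁ := η_ V (Vᘁ)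

/-- The right-pointing evaluation `V* ⊗ V ⟶ 𝟙`. -/
def evR (V : C) : Vᘁ ⊗ V ⟶ 𝟙_ C := ε_ V (Vᘁ)

/-- The left-pointing evaluation `V ⊗ V* ⟶ 𝟙` of a ribbon category, obtained from the
right-pointing one by means of the twist and the braiding. -/
def evL (V : C) : V ⊗ Vᘁ ⟶ 𝟙_ C := (twist V).hom ▷ (Vᘁ) ≫ (β_ V (Vᘁ)).hom ≫ evR V

/-- The right partial trace: close the strand `V` of an endomorphism of `U ⊗ V` on the right. -/
def ptr {U V : C} (f : U ⊗ V ⟶ U ⊗ V) : U ⟶ U :=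
  (ρ_ U).inv ≫ U ◁ coevR V ≫ (α_ U V (Vᘁ)).inv ≫ f ▷ (Vᘁ) ≫
    (α_ U V (Vᘁ)).hom ≫ U ◁ evL V ≫ (ρ_ U).hom

/-- The double braiding `c_{U,V} ∘ c_{V,U}` of `V ⊗ U`. -/
def doubleBraiding (V U : C) : V ⊗ U ≅ V ⊗ U := β_ V U ≪≫ β_ U V

/-- `Φ_{U,V}`: a `U`-coloured circle around a strand coloured with `V`. -/
def Phi (U V : C) : V ⟶ V := ptr (doubleBraiding V U).hom

/-- A `V`-strand of framing `-1`, linked positively with a `U`-circle of framing `-1`. -/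
def loopMinus (U V : C) : V ⟶ V :=
  ptr ((doubleBraiding V U).hom ≫ V ◁ (twist U).inv) ≫ (twist V).inv

/-- The mirror image of `loopMinus`: a `V`-strand of framing `+1`, linked negatively with a
`U`-circle of framing `+1`. -/
def loopPlus (U V : C) : V ⟶ V :=
  ptr ((doubleBraiding V U).inv ≫ V ◁ (twist U).hom) ≫ (twist V).hom

/-- An object is regular if its evaluation is an epimorphism. -/
def IsRegularObj (V : C) : Prop := Epi (evR V)

end Ribbon

/-- An object `V` is simple if `End(V) = 𝕜 · Id_V` (with `Id_V ≠ 0`): the canonical map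
`𝕜 → End(V)` is bijective. -/
def IsSimpleObj (𝕜 : Type*) [Field 𝕜] {C : Type u} [Category.{v} C] [Preadditive C]
    [Linear 𝕜 C] (V : C) : Prop :=
  Function.Bijective (fun a : 𝕜 => a • 𝟙 V)

/-- A linear ribbon category over `𝕜`: composition and tensor product are bilinear (this is
`Linear 𝕜 C` and `MonoidalLinear 𝕜 C`) and the canonical map `𝕜 → End(𝟙)` is bijective. -/
class LinearRibbonCategory (𝕜 : Type*) [Field 𝕜] (C : Type u) [Category.{v} C] [Preadditive C]
    [Linear 𝕜 C] [MonoidalCategory C] [MonoidalPreadditive C] [MonoidalLinear 𝕜 C]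
    [BraidedCategory C] [RightRigidCategory C] [RibbonCategory C] : Prop where
  unit_bijective : Function.Bijective (fun a : 𝕜 => a • 𝟙 (𝟙_ C))

/-- An ideal: a full subcategory that is stable under retracts and absorbs tensor products. -/
structure TensorIdeal (C : Type u) [Category.{v} C] [MonoidalCategory C] where
  mem : ObjectProperty C
  retract_mem : ∀ {V W : C} (a : V ⟶ W) (b : W ⟶ V), mem W → a ≫ b = 𝟙 V → mem V
  tensor_mem : ∀ {U : C}, mem U → ∀ V : C, mem (U ⊗ V)

/-- The ideal of projective objects. -/
def projIdeal (C : Type u) [Category.{v} C] [MonoidalCategory C] [RightRigidCategory C] :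
    TensorIdeal C where
  mem := fun P => Projective P
  retract_mem := by
    intro V W a b hW hab
    have hW' : Projective W := hW
    exact ⟨fun f e he => ⟨a ≫ Projective.factorThru (b ≫ f) e, by simp [reassoc_of% hab]⟩⟩
  tensor_mem := by
    intro U hU V
    have h1 : (tensorRight (Vᘁ)).PreservesEpimorphisms :=
      Functor.preservesEpimorphisms_of_adjunction (tensorRightAdjunction (Vᘁ : C) ((Vᘁ : C)ᘁ))
    exact (tensorRightAdjunction V (Vᘁ)).map_projective U hU

/-- A family `D` of objects of the full subcategory `P` is dominating if the identity of every
object of `P` is a finite sum of morphisms that factor through members of `D`. -/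
def IsDominating {C : Type u} [Category.{v} C] [Preadditive C] {J : Type*}
    (P : ObjectProperty C) (D : J → C) : Prop :=
  (∀ j, P (D j)) ∧
  ∀ V : C, P V → ∃ (m : ℕ) (a : Fin m → J) (ι : ∀ k, D (a k) ⟶ V) (s : ∀ k, V ⟶ D (a k)),
    𝟙 V = ∑ k, s k ≫ ι k

open Classical in
/-- A family of objects with `dim Hom(D i, D j) = δ_{i,j}`. -/
def IsCompletelyReduced (𝕜 : Type*) [Field 𝕜] {C : Type u} [Category.{v} C] [Preadditive C]
    [Linear 𝕜 C] {J : Type*} (D : J → C) : Prop :=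
  ∀ i j, Module.rank 𝕜 (D i ⟶ D j) = if i = j then 1 else 0

/-- `X` is the direct sum of the objects `Y g`, `g ∈ s`. -/
def IsDirectSum {C : Type u} [Category.{v} C] [Preadditive C] {G : Type*} (s : Finset G)
    (Y : G → C) (X : C) : Prop :=
  ∃ (ι : ∀ g, Y g ⟶ X) (π : ∀ g, X ⟶ Y g),
    (∀ g ∈ s, ι g ≫ π g = 𝟙 (Y g)) ∧
    (∀ g ∈ s, ∀ h ∈ s, g ≠ h → ι g ≫ π h = 0) ∧
    ∑ g ∈ s, π g ≫ ι g = 𝟙 X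

/-- A `G`-grading: full subcategories `C_g`, compatible with unit, duals and tensor products,
without nonzero morphisms between different degrees, such that `C` is (equivalent to) their
direct sum, that is, finite direct sums of homogeneous objects of different degrees exist and
every object is one. -/
structure Grading (C : Type u) [Category.{v} C] [Preadditive C] [MonoidalCategory C]
    [RightRigidCategory C] (G : Type*) [AddCommGroup G] where
  deg : G → ObjectProperty C
  unit_mem : deg 0 (𝟙_ C)
  dual_mem : ∀ {g : G} {V : C}, deg g V → deg (-g) (Vᘁ)
  tensor_mem : ∀ {g h : G} {V W : C}, deg g V → deg h W → deg (g + h) (V ⊗ W)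
  degree_eq : ∀ {g h : G} {V W : C}, deg g V → deg h W → (∃ f : V ⟶ W, f ≠ 0) → g = h
  exists_decomposition : ∀ X : C, ∃ (s : Finset G) (Y : G → C),
    (∀ g ∈ s, deg g (Y g)) ∧ IsDirectSum s Y X
  exists_sum : ∀ (s : Finset G) (Y : G → C), (∀ g ∈ s, deg g (Y g)) →
    ∃ X : C, IsDirectSum s Y X

/-- `X` is small in `G`: finitely many translates of `X` never cover `G`. -/
def IsSmall {G : Type*} [AddCommGroup G] (X : Set G) : Prop :=
  ∀ s : Finset G, (⋃ g ∈ s, (fun x => g + x) '' X) ≠ Set.univ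

/-- `X = -X`. -/
def IsSymmetric {G : Type*} [AddCommGroup G] (X : Set G) : Prop :=
  X = (fun x => -x) '' X

/-- A modified trace on an ideal. -/
structure MTrace (𝕜 : Type*) [Field 𝕜] {C : Type u} [Category.{v} C] [Preadditive C]
    [Linear 𝕜 C] [MonoidalCategory C] [BraidedCategory C] [RightRigidCategory C]
    [RibbonCategory C] (I : TensorIdeal C) where
  tr : ∀ V : C, I.mem V → ((V ⟶ V) →ₗ[𝕜] 𝕜)
  cyclic : ∀ {U V : C} (hU : I.mem U) (hV : I.mem V) (f : V ⟶ U) (g : U ⟶ V),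
    tr V hV (f ≫ g) = tr U hU (g ≫ f)
  partial_trace : ∀ {U V : C} (hU : I.mem U) (f : U ⊗ V ⟶ U ⊗ V),
    tr (U ⊗ V) (I.tensor_mem hU V) f = tr U hU (ptr f)

open Classical in
/-- The modified dimension `d(V) = t_V(Id_V)` of `V ∈ I` (and `0` by convention if `V ∉ I`). -/
noncomputable def MTrace.dim {𝕜 : Type*} [Field 𝕜] {C : Type u} [Category.{v} C] [Preadditive C]
    [Linear 𝕜 C] [MonoidalCategory C] [BraidedCategory C] [RightRigidCategory C]
    [RibbonCategory C] {I : TensorIdeal C} (t : MTrace 𝕜 I) (V : C) : 𝕜 :=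
  if h : I.mem V then t.tr V h (𝟙 V) else 0

/-- A free realisation of the commutative group `Z` in `C`. -/
structure FreeRealisation (𝕜 : Type*) [Field 𝕜] (C : Type u) [Category.{v} C] [Preadditive C]
    [Linear 𝕜 C] [MonoidalCategory C] [BraidedCategory C] [RightRigidCategory C]
    [RibbonCategory C] (Z : Type*) [AddCommGroup Z] where
  obj : Z → C
  zero_iso : Nonempty (obj 0 ≅ 𝟙_ C)
  qdim : ∀ k, coevR (obj k) ≫ evL (obj k) = 𝟙 (𝟙_ C) ∨ coevR (obj k) ≫ evL (obj k) = -𝟙 (𝟙_ C)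
  add_iso : ∀ j k, Nonempty (obj j ⊗ obj k ≅ obj (j + k))
  twist_eq : ∀ k, (twist (obj k)).hom = 𝟙 (obj k)
  free : ∀ V : C, IsSimpleObj 𝕜 V → ∀ k, Nonempty (V ⊗ obj k ≅ V) ↔ k = 0

/-- A pre-modular `G`-category relative to `(Z, X)`: the structure on the linear ribbon category
`C` over `𝕜`, including the choice, for each `g ∉ X`, of the finite family
`Θ(g) = {V_i | i ∈ I_g}`, with `I_g = Fin (card g)`. For `g ∈ X` nothing is required of it. -/
structure RelPreModular (𝕜 : Type*) [Field 𝕜] (C : Type u) [Category.{v} C] [Preadditive C]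
    [Linear 𝕜 C] [MonoidalCategory C] [MonoidalPreadditive C] [MonoidalLinear 𝕜 C]
    [BraidedCategory C] [RightRigidCategory C] [RibbonCategory C] [LinearRibbonCategory 𝕜 C]
    (G : Type*) [AddCommGroup G] (Z : Type*) [AddCommGroup Z] (X : Set G) where
  small : IsSmall X
  symmetric : IsSymmetric X
  grading : Grading C G
  /-- no homogeneous component is null -/
  exists_nonzero : ∀ g, ∃ V, grading.deg g V ∧ 𝟙 V ≠ 0
  σ : FreeRealisation 𝕜 C Z
  σ_mem : ∀ k, grading.deg 0 (σ.obj k)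
  t : MTrace 𝕜 (projIdeal C)
  t_ne_zero : ∃ (V : C) (hV : (projIdeal C).mem V) (f : V ⟶ V), t.tr V hV f ≠ 0
  card : G → ℕ
  V : ∀ g, Fin (card g) → C
  V_mem : ∀ g, g ∉ X → ∀ i, grading.deg g (V g i)
  V_simple : ∀ g, g ∉ X → ∀ i, IsSimpleObj 𝕜 (V g i)
  V_regular : ∀ g, g ∉ X → ∀ i, IsRegularObj (V g i)
  dominating : ∀ g, g ∉ X →
    IsDominating (grading.deg g) (fun p : Fin (card g) × Z => V g p.1 ⊗ σ.obj p.2)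
  completely_reduced : ∀ g, g ∉ X →
    IsCompletelyReduced 𝕜 (fun p : Fin (card g) × Z => V g p.1 ⊗ σ.obj p.2)
  /-- compatibility: there is a bilinear map `ψ : G × Z → 𝕜ˣ` that gives the double braiding
  with `σ(k)` -/
  compatibility : ∃ ψ : G →+ Z →+ Additive 𝕜ˣ, ∀ (g : G) (W : C) (k : Z), grading.deg g W →
    (doubleBraiding W (σ.obj k)).hom = (((ψ g k).toMul : 𝕜ˣ) : 𝕜) • 𝟙 (W ⊗ σ.obj k)

namespace RelPreModular

variable {𝕜 : Type*} [Field 𝕜] {C : Type u} [Category.{v} C] [Preadditive C]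
  [Linear 𝕜 C] [MonoidalCategory C] [MonoidalPreadditive C] [MonoidalLinear 𝕜 C]
  [BraidedCategory C] [RightRigidCategory C] [RibbonCategory C] [LinearRibbonCategory 𝕜 C]
  {G : Type*} [AddCommGroup G] {Z : Type*} [AddCommGroup Z] {X : Set G}

/-- The modified dimension `d(V_i)`, `i ∈ I_g`. -/
noncomputable def d (M : RelPreModular 𝕜 C G Z X) (g : G) (i : Fin (M.card g)) : 𝕜 :=
  M.t.dim (M.V g i)

/-- The value of a diagram with one component coloured by the Kirby color
`Ω_g = ∑ i ∈ I_g, d(V_i) · V_i`; `F U` is its value when that component is coloured by `U`. -/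
noncomputable def kirby (M : RelPreModular 𝕜 C G Z X) (g : G) {A B : C}
    (F : C → (A ⟶ B)) : A ⟶ B :=
  ∑ i, M.d g i • F (M.V g i)

/-- `Δ` is the scalar `Δ₊`. -/
def IsDeltaPlus (M : RelPreModular 𝕜 C G Z X) (Δ : 𝕜) : Prop :=
  ∀ g, g ∉ X → ∀ W : C, M.grading.deg g W → M.kirby g (fun U => loopPlus U W) = Δ • 𝟙 W

/-- `Δ` is the scalar `Δ₋`. -/
def IsDeltaMinus (M : RelPreModular 𝕜 C G Z X) (Δ : 𝕜) : Prop :=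
  ∀ g, g ∉ X → ∀ W : C, M.grading.deg g W → M.kirby g (fun U => loopMinus U W) = Δ • 𝟙 W

/-- The endomorphism `d(V_i) · Φ_{Ω_h, V_i ⊗ V_j*}` of `V_i ⊗ V_j*`, `i, j ∈ I_g`. -/
noncomputable def modMor (M : RelPreModular 𝕜 C G Z X) (g h : G) (i j : Fin (M.card g)) :
    M.V g i ⊗ (M.V g j)ᘁ ⟶ M.V g i ⊗ (M.V g j)ᘁ :=
  M.d g i • M.kirby h (fun U => Phi U (M.V g i ⊗ (M.V g j)ᘁ))

/-- `ζ ≠ 0` is a modularity parameter: for all `g, h ∉ X` and `i, j ∈ I_g`, the endomorphism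
`d(V_i) · Φ_{Ω_h, V_i ⊗ V_j*}` equals `δ_{i,j} ζ` times evaluation followed by coevaluation. -/
def IsModularityParameter (M : RelPreModular 𝕜 C G Z X) (ζ : 𝕜) : Prop :=
  ζ ≠ 0 ∧ ∀ g, g ∉ X → ∀ h, h ∉ X →
    (∀ i, M.modMor g h i i = ζ • (evL (M.V g i) ≫ coevR (M.V g i))) ∧
    (∀ i j, i ≠ j → M.modMor g h i j = 0)

/-- `C` is a modular `G`-category relative to `(Z, X)`. -/
def IsRelModular (M : RelPreModular 𝕜 C G Z X) : Prop :=
  ∃ ζ : 𝕜, M.IsModularityParameter ζ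

end RelPreModular

end RelMod

/-! A circle coloured `U` can be recoloured by `Uᘁ` at the price of reversing its linking. The
balancing axiom then absorbs linking and framings into one twist: `loopPlus U V` and `loopMinus U V`
are the partial traces over `Uᘁ` of the twist of `V ⊗ Uᘁ` and of its inverse. Both Kirby-coloured
sums are thus instances of `kirbyLoop`, for a natural endomorphism `ϑ` of the identity functor.

Existence of `Δ₊` and `Δ₋` rests on the handle slide `slide`. For `V` of degree `g`, `W` of degree
`h`, and `g`, `g + h` generic (outside `X`), the m-trace of `x` followed by the loop around `V ⊗ W`
(colours in `I_{g+h}`) equals that of `ptr x` followed by the loop around `V` (colours in `I_g`). To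
see this, split `W ⊗ V_kᘁ` and `Wᘁ ⊗ V_iᘁ` through objects `V_iᘁ ⊗ σ(m)` and `V_kᘁ ⊗ σ(n)`; the
coefficients on the two sides are pairings that cyclicity identifies up to modified dimensions and
the signs of `σ`. If the loop on `V` is a scalar `c`, nondegeneracy of the trace form in generic
degrees makes the loop on `V ⊗ W` the same scalar. With `V = V_j` and `W = V_jᘁ ⊗ A`, regularity of
`V_j` gives an epimorphism onto `A`, so by naturality every generic `A` has loop value `c`.

For `ζ = Δ₊Δ₋`, the modularity identity is placed beside a strand `W` of degree `h`, composed with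
an inverse twist and a test morphism `z`, traced, and summed over `j` with weights `d(V_j)`.
Modularity yields `ζ`. Alternatively, `T_meridian` exchanges the circle around `V_i ⊗ V_jᘁ` for one
linked with `W`; the sum over `j` becomes a `-1`-framed Kirby loop, worth `Δ₋`, and the remaining
circle a `+1`-framed one on `W`, worth `Δ₊`. If `h + g` is generic, some `z` has nonzero trace, and
since `d(V_i) ≠ 0` the common factors cancel. -/

namespace RelMod

universe v u

set_option linter.unusedSectionVars false

/-! ### Duality and twist in a ribbon category -/

section RibbonCalculus

variable {C : Type u} [Category.{v} C] [MonoidalCategory C] [BraidedCategory C]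
  [RightRigidCategory C] [RibbonCategory C]

lemma twist_hom_naturality {X Y : C} (f : X ⟶ Y) :
    f ≫ (twist Y).hom = (twist X).hom ≫ f := RibbonCategory.twist_naturality f

lemma twist_hom_tensor (X Y : C) : (twist (X ⊗ Y)).hom =
    ((twist X).hom ⊗ₘ (twist Y).hom) ≫ (doubleBraiding X Y).hom :=
  RibbonCategory.twist_tensor X Y

/-- Naturality along `𝟙 ⊗ 𝟙 ≅ 𝟙` gives `θ = θ ≫ θ`, and `θ` is invertible. -/
lemma twist_unit : (twist (𝟙_ C)).hom = 𝟙 (𝟙_ C) := by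
  have h1 := twist_hom_naturality (λ_ (𝟙_ C)).hom
  rw [twist_hom_tensor] at h1
  simp [doubleBraiding, MonoidalCategory.tensorHom_def, unitors_equal, unitors_inv_equal] at h1
  exact ((cancel_epi (twist (𝟙_ C)).hom).1 ((Category.comp_id _).trans h1)).symm

lemma coevR_twist (U : C) : coevR U ≫ (twist (U ⊗ Uᘁ)).hom = coevR U := by
  rw [twist_hom_naturality, twist_unit, Category.id_comp]

lemma twist_evR (U : C) : (twist (Uᘁ ⊗ U)).hom ≫ evR U = evR U := by
  rw [← twist_hom_naturality, twist_unit, Category.comp_id]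

lemma coevR_mate {U V : C} (s : U ⟶ V) : coevR V ≫ V ◁ (rightAdjointMate s) = coevR U ≫ s ▷ Uᘁ :=
  coevaluation_comp_rightAdjointMate s

lemma evR_mate {U V : C} (s : U ⟶ V) : rightAdjointMate s ▷ U ≫ evR U = Vᘁ ◁ s ≫ evR V :=
  rightAdjointMate_comp_evaluation s

lemma evL_mate {U V : C} (s : U ⟶ V) : U ◁ rightAdjointMate s ≫ evL U = s ▷ Vᘁ ≫ evL V := by
  have h : s ▷ Vᘁ ≫ (twist V).hom ▷ Vᘁ = (twist U).hom ▷ Vᘁ ≫ s ▷ Vᘁ := by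
    rw [← comp_whiskerRight, ← comp_whiskerRight, twist_hom_naturality]
  rw [evL, evL, reassoc_of% h, whisker_exchange_assoc,
    BraidedCategory.braiding_naturality_left_assoc, ← evR_mate, BraidedCategory.braiding_naturality_right_assoc]

/-- The left-pointing coevaluation `𝟙 ⟶ V* ⊗ V`. -/
def coevL (U : C) : 𝟙_ C ⟶ Uᘁ ⊗ U := (coevR U ≫ (β_ (Uᘁ) U).inv) ≫ Uᘁ ◁ (twist U).inv

/-- The left-pointing duality morphisms form an exact pairing. -/
@[reducible] def leftPairing (U : C) : ExactPairing (Uᘁ) U :=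
  @exactPairingCongrRight _ _ _ _ _ _ (BraidedCategory.exactPairing_swap U Uᘁ) (twist U)

lemma coevL_evL (U : C) : U ◁ coevL U ≫ (α_ _ _ _).inv ≫ evL U ▷ U = (ρ_ U).hom ≫ (λ_ U).inv :=
  (leftPairing U).coevaluation_evaluation'

lemma evL_coevL (U : C) :
    coevL U ▷ Uᘁ ≫ (α_ _ _ _).hom ≫ Uᘁ ◁ evL U = (λ_ Uᘁ).hom ≫ (ρ_ Uᘁ).inv :=
  (leftPairing U).evaluation_coevaluation'

lemma coevR_evR (U : C) : Uᘁ ◁ coevR U ≫ (α_ _ _ _).inv ≫ evR U ▷ Uᘁ =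
    (ρ_ Uᘁ).hom ≫ (λ_ Uᘁ).inv := ExactPairing.coevaluation_evaluation U (Uᘁ)

lemma evR_coevR (U : C) :
    coevR U ▷ U ≫ (α_ _ _ _).hom ≫ U ◁ evR U = (λ_ U).hom ≫ (ρ_ U).inv :=
  ExactPairing.evaluation_coevaluation U (Uᘁ)

lemma coevR_twist_dual (U : C) :
    coevR U ≫ U ◁ (twist (Uᘁ)).hom = coevR U ≫ (twist U).hom ▷ Uᘁ := by
  rw [RibbonCategory.twist_dual]; exact coevR_mate _

/-- The coevaluation absorbs the twist of `U ⊗ Uᘁ`, and a twist on `Uᘁ` can be moved to `U`; hence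
two twists on `U` undo a full double braiding. -/
lemma coevL_eq (U : C) :
    coevL U = coevR U ≫ (β_ U (Uᘁ)).hom ≫ Uᘁ ◁ (twist U).hom := by
  have h := coevR_twist U
  rw [twist_hom_tensor, tensorHom_def', Category.assoc, ← Category.assoc,
    coevR_twist_dual] at h
  simp only [Category.assoc] at h
  have h2 : coevR U ≫ (twist U).hom ▷ Uᘁ ≫ (twist U).hom ▷ Uᘁ ≫ (β_ U (Uᘁ)).hom =
      coevR U ≫ (β_ (Uᘁ) U).inv := by
    nth_rewrite 2 [← h]
    simp [doubleBraiding]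
  rw [coevL, ← h2]
  simp

lemma evL_eq (U : C) : evL U = (β_ (Uᘁ) U).inv ≫ Uᘁ ◁ (twist U).inv ≫ evR U := by
  have h := twist_evR U
  rw [twist_hom_tensor, MonoidalCategory.tensorHom_def, RibbonCategory.twist_dual] at h
  have h2 : Uᘁ ◁ (twist U).inv ≫ evR U = rightAdjointMate (twist U).hom ▷ U ≫
      (doubleBraiding (Uᘁ) U).hom ≫ evR U := by
    rw [← cancel_epi (Uᘁ ◁ (twist U).hom)]
    simp only [← whisker_exchange_assoc, Category.assoc] at h ⊢
    rw [h]; simp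
  have h3 : rightAdjointMate (twist U).hom ▷ U ≫ (doubleBraiding (Uᘁ) U).hom ≫ evR U =
      (doubleBraiding (Uᘁ) U).hom ≫ Uᘁ ◁ (twist U).hom ≫ evR U := by
    simp only [doubleBraiding, Iso.trans_hom, Category.assoc]
    rw [BraidedCategory.braiding_naturality_left_assoc,
      BraidedCategory.braiding_naturality_right_assoc,
      evR_mate]
  rw [h2, h3, evL, doubleBraiding]
  simp

/-- The duals of `Uᘁ` in the two pairings are isomorphic. -/
noncomputable def doubleDualIso (U : C) : U ≅ (Uᘁ)ᘁ :=
  rightDualIso (leftPairing U) (inferInstance : ExactPairing (Uᘁ) ((Uᘁ)ᘁ))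

lemma coevL_doubleDualIso (U : C) : coevL U ≫ Uᘁ ◁ (doubleDualIso U).hom = coevR (Uᘁ) := by
  have := @coevaluation_comp_rightAdjointMate _ _ _ (Uᘁ) (Uᘁ) ⟨(Uᘁ)ᘁ⟩
    (@HasRightDual.mk _ _ _ _ U (leftPairing U)) (𝟙 _)
  rw [id_whiskerRight, Category.comp_id] at this
  exact this

lemma doubleDualIso_evR (U : C) : (doubleDualIso U).hom ▷ Uᘁ ≫ evR (Uᘁ) = evL U := by
  have := @rightAdjointMate_comp_evaluation _ _ _ (Uᘁ) (Uᘁ) ⟨(Uᘁ)ᘁ⟩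
    (@HasRightDual.mk _ _ _ _ U (leftPairing U)) (𝟙 _)
  rw [whiskerLeft_id, Category.id_comp] at this
  exact this

lemma doubleDualIso_evL (U : C) : Uᘁ ◁ (doubleDualIso U).hom ≫ evL (Uᘁ) = evR U := by
  rw [evL, whisker_exchange_assoc, BraidedCategory.braiding_naturality_right_assoc,
    doubleDualIso_evR, evL]
  have h := twist_evR U
  rw [twist_hom_tensor, MonoidalCategory.tensorHom_def] at h
  simp only [doubleBraiding, Iso.trans_hom, Category.assoc] at h
  rwa [BraidedCategory.braiding_naturality_right_assoc] at h

/-- The right partial trace of an endomorphism of `X ⊗ Uᘁ`, closed by means of `U`. -/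
def ptrDual {X U : C} (f : X ⊗ Uᘁ ⟶ X ⊗ Uᘁ) : X ⟶ X :=
  (ρ_ X).inv ≫ X ◁ coevL U ≫ (α_ X (Uᘁ) U).inv ≫ f ▷ U ≫
    (α_ X (Uᘁ) U).hom ≫ X ◁ evR U ≫ (ρ_ X).hom

/-- The isomorphism between `U` and its double dual occurs once in the cup and once in the cap, and
cancels around the circle. -/
lemma ptr_eq_ptrDual {X U : C} (f : X ⊗ Uᘁ ⟶ X ⊗ Uᘁ) : ptr f = ptrDual f := by
  have h : f ▷ U ≫ (α_ X (Uᘁ) U).hom ≫ X ◁ Uᘁ ◁ (doubleDualIso U).hom =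
      (α_ X (Uᘁ) U).hom ≫ X ◁ Uᘁ ◁ (doubleDualIso U).hom ≫ (α_ X (Uᘁ) ((Uᘁ)ᘁ)).inv ≫
        f ▷ _ ≫ (α_ X (Uᘁ) _).hom := by
    rw [← associator_naturality_right, ← associator_naturality_right_assoc, Iso.hom_inv_id_assoc,
      whisker_exchange_assoc]
  rw [ptr, ptrDual, ← coevL_doubleDualIso, ← doubleDualIso_evL]
  simp only [MonoidalCategory.whiskerLeft_comp, Category.assoc]
  rw [reassoc_of% h]
  simp

/-- The left partial trace. -/
def ptrLeft {U X : C} (f : U ⊗ X ⟶ U ⊗ X) : X ⟶ X :=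
  (λ_ X).inv ≫ coevL U ▷ X ≫ (α_ (Uᘁ) U X).hom ≫ Uᘁ ◁ f ≫
    (α_ (Uᘁ) U X).inv ≫ evR U ▷ X ≫ (λ_ X).hom

/-! ### Partial traces -/

lemma ptr_naturality {X Y U : C} (s : X ⟶ Y) (f : X ⊗ U ⟶ X ⊗ U) (g : Y ⊗ U ⟶ Y ⊗ U)
    (h : s ▷ U ≫ g = f ≫ s ▷ U) : s ≫ ptr g = ptr f ≫ s := by
  simp only [ptr, Category.assoc]
  have h' : s ▷ U ▷ Uᘁ ≫ g ▷ Uᘁ = f ▷ Uᘁ ≫ s ▷ U ▷ Uᘁ := by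
    rw [← comp_whiskerRight, h, comp_whiskerRight]
  rw [← rightUnitor_naturality, whisker_exchange_assoc, ← associator_naturality_left_assoc,
    ← reassoc_of% h', ← associator_inv_naturality_left_assoc, whisker_exchange_assoc,
    rightUnitor_inv_naturality_assoc]

lemma ptr_comp_whiskerRight {X U : C} (f : X ⊗ U ⟶ X ⊗ U) (g : X ⟶ X) :
    ptr (f ≫ g ▷ U) = ptr f ≫ g := by
  simp only [ptr, Category.assoc, comp_whiskerRight]
  rw [← rightUnitor_naturality, whisker_exchange_assoc, associator_naturality_left_assoc]

lemma ptr_whiskerRight_comp {X U : C} (f : X ⊗ U ⟶ X ⊗ U) (g : X ⟶ X) :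
    ptr (g ▷ U ≫ f) = g ≫ ptr f := by
  simp only [ptr, Category.assoc, comp_whiskerRight]
  rw [← associator_inv_naturality_left_assoc, whisker_exchange_assoc,
    ← rightUnitor_inv_naturality_assoc]

lemma ptr_whiskerLeft {X Y U : C} (f : Y ⊗ U ⟶ Y ⊗ U) :
    ptr ((α_ X Y U).hom ≫ X ◁ f ≫ (α_ X Y U).inv) = X ◁ ptr f := by
  simp only [ptr]
  monoidal

lemma ptr_id (X U : C) : ptr (𝟙 (X ⊗ U)) = (ρ_ X).inv ≫ X ◁ (coevR U ≫ evL U) ≫ (ρ_ X).hom := by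
  simp [ptr]

/-- Closing `U` in the endomorphism `evL ≫ coevR` of `U ⊗ Uᘁ` straightens the strand. -/
lemma ptr_evL_coevR (U : C) : ptr (evL U ≫ coevR U) = 𝟙 U := by
  rw [ptr_eq_ptrDual, ptrDual]
  have h1 := coevL_evL U
  have h2 := evR_coevR U
  rw [comp_whiskerRight, Category.assoc, reassoc_of% h1, reassoc_of% h2]
  simp

lemma ptrLeft_evL_coevR (U : C) : ptrLeft (evL U ≫ coevR U) = 𝟙 (Uᘁ) := by
  rw [ptrLeft]
  have h1 := evL_coevL U
  have h2 := coevR_evR U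
  rw [MonoidalCategory.whiskerLeft_comp, Category.assoc, reassoc_of% h1, reassoc_of% h2]
  simp

/-- Gives the trace over `Uᘁ` the same cup and cap as a trace over `U`, at the cost of crossing the
two strands; `ptrDual_eq'` uses the opposite crossing. -/
lemma ptrDual_eq (X U : C) (f : X ⊗ Uᘁ ⟶ X ⊗ Uᘁ) : ptrDual f =
    (ρ_ X).inv ≫ X ◁ coevR U ≫ (X ◁ (β_ U (Uᘁ)).hom ≫ (α_ X (Uᘁ) U).inv ≫ f ▷ U ≫
    (α_ X (Uᘁ) U).hom ≫ X ◁ (β_ U (Uᘁ)).inv) ≫ X ◁ evL U ≫ (ρ_ X).hom := by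
  have h : X ◁ Uᘁ ◁ (twist U).hom ≫ (α_ X (Uᘁ) U).inv ≫ f ▷ U ≫ (α_ X (Uᘁ) U).hom =
      (α_ X (Uᘁ) U).inv ≫ f ▷ U ≫ (α_ X (Uᘁ) U).hom ≫ X ◁ Uᘁ ◁ (twist U).hom := by
    rw [← associator_naturality_right, associator_inv_naturality_right_assoc,
      whisker_exchange_assoc]
  rw [ptrDual, coevL_eq]
  simp only [MonoidalCategory.whiskerLeft_comp, Category.assoc, reassoc_of% h]
  have h2 : (β_ U (Uᘁ)).inv ≫ evL U = Uᘁ ◁ (twist U).hom ≫ evR U := by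
    rw [evL, BraidedCategory.braiding_naturality_left_assoc, Iso.inv_hom_id_assoc]
  rw [← MonoidalCategory.whiskerLeft_comp_assoc _ (β_ U (Uᘁ)).inv, h2]
  simp only [MonoidalCategory.whiskerLeft_comp, Category.assoc]

lemma ptrDual_eq' (X U : C) (f : X ⊗ Uᘁ ⟶ X ⊗ Uᘁ) : ptrDual f =
    (ρ_ X).inv ≫ X ◁ coevR U ≫ (X ◁ (β_ (Uᘁ) U).inv ≫ (α_ X (Uᘁ) U).inv ≫ f ▷ U ≫
    (α_ X (Uᘁ) U).hom ≫ X ◁ (β_ (Uᘁ) U).hom) ≫ X ◁ evL U ≫ (ρ_ X).hom := by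
  have h : X ◁ Uᘁ ◁ (twist U).inv ≫ (α_ X (Uᘁ) U).inv ≫ f ▷ U ≫ (α_ X (Uᘁ) U).hom =
      (α_ X (Uᘁ) U).inv ≫ f ▷ U ≫ (α_ X (Uᘁ) U).hom ≫ X ◁ Uᘁ ◁ (twist U).inv := by
    rw [← associator_naturality_right, associator_inv_naturality_right_assoc,
      whisker_exchange_assoc]
  rw [ptrDual, coevL, evL_eq]
  simp only [MonoidalCategory.whiskerLeft_comp, Category.assoc, reassoc_of% h,
    whiskerLeft_hom_inv_assoc]

/-! ### Double braidings and reversal of circles -/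

lemma doubleBraiding_naturality_right {X U V : C} (s : U ⟶ V) :
    X ◁ s ≫ (doubleBraiding X V).hom = (doubleBraiding X U).hom ≫ X ◁ s := by
  simp [doubleBraiding, BraidedCategory.braiding_naturality_right_assoc,
    BraidedCategory.braiding_naturality_left]

lemma doubleBraiding_naturality_left {X Y U : C} (s : X ⟶ Y) :
    s ▷ U ≫ (doubleBraiding Y U).hom = (doubleBraiding X U).hom ≫ s ▷ U := by
  simp [doubleBraiding, BraidedCategory.braiding_naturality_right,
    BraidedCategory.braiding_naturality_left_assoc]

lemma doubleBraiding_unit (X : C) : (doubleBraiding X (𝟙_ C)).hom = 𝟙 _ := by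
  simp [doubleBraiding]

lemma coevR_doubleBraiding (X U : C) :
    X ◁ coevR U ≫ (doubleBraiding X (U ⊗ Uᘁ)).hom = X ◁ coevR U := by
  rw [doubleBraiding_naturality_right, doubleBraiding_unit, Category.id_comp]

/-- The double braiding of `X` with `U`, acting on `X ⊗ U ⊗ W`. -/
def doubleBraidingFirst (X U W : C) : X ⊗ (U ⊗ W) ≅ X ⊗ (U ⊗ W) :=
  (α_ X U W).symm ≪≫ whiskerRightIso (doubleBraiding X U) W ≪≫ α_ X U W

/-- An endomorphism of `X ⊗ W`, acting on `X ⊗ U ⊗ W` behind or in front of `U`. -/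
def overFirst (X U W : C) : X ⊗ (U ⊗ W) ≅ (X ⊗ W) ⊗ U :=
  whiskerLeftIso X (β_ U W) ≪≫ (α_ X W U).symm

def underFirst (X U W : C) : X ⊗ (U ⊗ W) ≅ (X ⊗ W) ⊗ U :=
  whiskerLeftIso X (β_ W U).symm ≪≫ (α_ X W U).symm

/-- Encircling two parallel strands is encircling them one after the other. The two orders, here and
in `doubleBraiding_tensor_under`, serve the two signs of linking. -/
lemma doubleBraiding_tensor_over (X U W : C) : (doubleBraiding X (U ⊗ W)).hom =
    (doubleBraidingFirst X U W).hom ≫ (overFirst X U W).hom ≫ (doubleBraiding X W).hom ▷ U ≫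
      (overFirst X U W).inv := by
  have h : (overFirst X U W).hom = (α_ X U W).inv ≫ (β_ U X).inv ▷ W ≫ (α_ U X W).hom ≫
      (β_ U (X ⊗ W)).hom := by
    simp [overFirst, BraidedCategory.braiding_tensor_right_hom]
  have h' : (overFirst X U W).inv = (β_ U (X ⊗ W)).inv ≫ (α_ U X W).inv ≫ (β_ U X).hom ▷ W ≫
      (α_ X U W).hom := by
    simp [overFirst, BraidedCategory.braiding_tensor_right_inv]
  rw [h, h']
  simp only [Category.assoc]
  rw [← BraidedCategory.braiding_naturality_right_assoc]
  simp [doubleBraidingFirst, doubleBraiding, BraidedCategory.braiding_tensor_right_hom,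
    BraidedCategory.braiding_tensor_left_hom]

lemma doubleBraiding_tensor_under (X U W : C) : (doubleBraiding X (U ⊗ W)).hom =
    (underFirst X U W).hom ≫ (doubleBraiding X W).hom ▷ U ≫
      (underFirst X U W).inv ≫ (doubleBraidingFirst X U W).hom := by
  have h : (underFirst X U W).hom = (α_ X U W).inv ≫ (β_ X U).hom ▷ W ≫ (α_ U X W).hom ≫
      (β_ (X ⊗ W) U).inv := by
    simp [underFirst, BraidedCategory.braiding_tensor_left_inv]
  have h' : (underFirst X U W).inv = (β_ (X ⊗ W) U).hom ≫ (α_ U X W).inv ≫ (β_ X U).inv ▷ W ≫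
      (α_ X U W).hom := by
    simp [underFirst, BraidedCategory.braiding_tensor_left_hom]
  rw [h, h']
  simp only [Category.assoc]
  rw [← BraidedCategory.braiding_inv_naturality_right_assoc]
  simp [doubleBraidingFirst, doubleBraiding, BraidedCategory.braiding_tensor_right_hom,
    BraidedCategory.braiding_tensor_left_hom]

lemma overFirst_inv_naturality {X U V W : C} (s : V ⟶ W) :
    (X ◁ s) ▷ U ≫ (overFirst X U W).inv = (overFirst X U V).inv ≫ X ◁ U ◁ s := by
  simp [overFirst, ← MonoidalCategory.whiskerLeft_comp]

lemma underFirst_inv_naturality {X U V W : C} (s : V ⟶ W) :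
    (X ◁ s) ▷ U ≫ (underFirst X U W).inv = (underFirst X U V).inv ≫ X ◁ U ◁ s := by
  simp [underFirst, ← MonoidalCategory.whiskerLeft_comp]

lemma ptr_comp_whiskerLeft {X U : C} (f : X ⊗ U ⟶ X ⊗ U) (u : U ⟶ U) :
    ptr (f ≫ X ◁ u) = (ρ_ X).inv ≫ (X ◁ coevR U ≫ (α_ X U (Uᘁ)).inv ≫ f ▷ Uᘁ ≫
      (α_ X U (Uᘁ)).hom) ≫ X ◁ U ◁ rightAdjointMate u ≫ X ◁ evL U ≫ (ρ_ X).hom := by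
  rw [ptr, ← MonoidalCategory.whiskerLeft_comp_assoc _ (U ◁ rightAdjointMate u), evL_mate]
  simp

/-- A positively linked circle coloured with `U` is a negatively linked circle coloured
with `Uᘁ`. -/
lemma ptr_doubleBraiding {X U : C} (u : U ⟶ U) : ptr ((doubleBraiding X U).hom ≫ X ◁ u) =
    ptr ((doubleBraiding X (Uᘁ)).inv ≫ X ◁ rightAdjointMate u) := by
  -- The double braiding with `U ⊗ Uᘁ` is trivial on the coevaluation, so its factor at `U` is
  -- inverse to its factor at `Uᘁ`.
  have key : X ◁ coevR U ≫ (α_ X U (Uᘁ)).inv ≫ (doubleBraiding X U).hom ▷ Uᘁ ≫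
      (α_ X U (Uᘁ)).hom = X ◁ coevR U ≫ (overFirst X U (Uᘁ)).hom ≫
        (doubleBraiding X (Uᘁ)).inv ▷ U ≫ (overFirst X U (Uᘁ)).inv := by
    have h := coevR_doubleBraiding X U
    rw [doubleBraiding_tensor_over, doubleBraidingFirst] at h
    nth_rewrite 2 [← h]
    simp
  rw [ptr_eq_ptrDual, ptrDual_eq, ptr_comp_whiskerLeft, key]
  have h2 := overFirst_inv_naturality (X := X) (U := U) (rightAdjointMate u)
  simp only [overFirst, Iso.trans_inv, Iso.symm_inv, whiskerLeftIso_inv, Iso.trans_hom,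
    Iso.symm_hom, whiskerLeftIso_hom, Category.assoc, comp_whiskerRight] at h2 ⊢
  rw [reassoc_of% h2]

lemma ptr_doubleBraiding_inv {X U : C} (u : U ⟶ U) : ptr ((doubleBraiding X U).inv ≫ X ◁ u) =
    ptr ((doubleBraiding X (Uᘁ)).hom ≫ X ◁ rightAdjointMate u) := by
  have key : X ◁ coevR U ≫ (α_ X U (Uᘁ)).inv ≫ (doubleBraiding X U).inv ▷ Uᘁ ≫
      (α_ X U (Uᘁ)).hom = X ◁ coevR U ≫ (underFirst X U (Uᘁ)).hom ≫
        (doubleBraiding X (Uᘁ)).hom ▷ U ≫ (underFirst X U (Uᘁ)).inv := by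
    have h := coevR_doubleBraiding X U
    rw [doubleBraiding_tensor_under, doubleBraidingFirst] at h
    nth_rewrite 1 [← h]
    simp
  rw [ptr_eq_ptrDual, ptrDual_eq', ptr_comp_whiskerLeft, key]
  have h2 := underFirst_inv_naturality (X := X) (U := U) (rightAdjointMate u)
  simp only [underFirst, Iso.trans_inv, Iso.symm_inv, whiskerLeftIso_inv, Iso.trans_hom,
    Iso.symm_hom, whiskerLeftIso_hom, Category.assoc, comp_whiskerRight] at h2 ⊢
  rw [reassoc_of% h2]

lemma twist_inv_naturality {X Y : C} (f : X ⟶ Y) :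
    f ≫ (twist Y).inv = (twist X).inv ≫ f := by
  rw [Iso.comp_inv_eq, Category.assoc, twist_hom_naturality, Iso.inv_hom_id_assoc]

lemma rightAdjointMate_twist_inv (U : C) : rightAdjointMate (twist U).inv = (twist (Uᘁ)).inv := by
  rw [← cancel_epi (twist (Uᘁ)).hom, Iso.hom_inv_id]
  rw [RibbonCategory.twist_dual]
  rw [← comp_rightAdjointMate, Iso.inv_hom_id, rightAdjointMate_id]

lemma twist_inv_tensor (X Y : C) : (twist (X ⊗ Y)).inv = (doubleBraiding X Y).inv ≫
    X ◁ (twist Y).inv ≫ (twist X).inv ▷ Y := by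
  rw [← cancel_epi (twist (X ⊗ Y)).hom, Iso.hom_inv_id, twist_hom_tensor]
  simp [MonoidalCategory.tensorHom_def]

lemma Phi_eq (U X : C) : Phi U X = ptr (doubleBraiding X (Uᘁ)).inv := by
  have := ptr_doubleBraiding (X := X) (𝟙 U)
  simpa [Phi] using this

/-- After reversal of the circle, the linking and the two framings are exactly the three factors of
the inverse twist of a tensor product. -/
lemma loopMinus_eq (U V : C) : loopMinus U V = ptr (twist (V ⊗ Uᘁ)).inv := by
  rw [loopMinus, ptr_doubleBraiding, ← ptr_comp_whiskerRight, rightAdjointMate_twist_inv,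
    twist_inv_tensor, Category.assoc]

lemma loopPlus_eq (U V : C) : loopPlus U V = ptr (twist (V ⊗ Uᘁ)).hom := by
  rw [loopPlus, ptr_doubleBraiding_inv, ← ptr_comp_whiskerRight, ← RibbonCategory.twist_dual,
    twist_hom_tensor, Category.assoc, MonoidalCategory.tensorHom_def, Category.assoc,
    doubleBraiding_naturality_right,
    reassoc_of% (doubleBraiding_naturality_left (U := Uᘁ) (twist V).hom), whisker_exchange]

/-- The axioms of an m-trace only mention right partial traces; this isotopy, which swings the
closed strand around `Y`, supplies the left ones. -/
lemma ptr_braiding_conj {W Y : C} (g : W ⊗ Y ⟶ W ⊗ Y) :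
    ptr ((β_ Y W).hom ≫ g ≫ (β_ Y W).inv) = ptrLeft g := by
  have e : (α_ Y W (Wᘁ)).symm ≪≫ whiskerRightIso (β_ Y W) (Wᘁ) ≪≫ β_ (W ⊗ Y) (Wᘁ) =
      β_ Y (W ⊗ Wᘁ) ≪≫ whiskerRightIso (β_ W (Wᘁ)) Y ≪≫ α_ _ _ _ := by
    ext
    simp [BraidedCategory.braiding_tensor_right_hom, BraidedCategory.braiding_tensor_left_hom]
  have e1 := congrArg Iso.hom e
  have e2 := congrArg Iso.inv e
  simp only [Iso.trans_hom, Iso.trans_inv, Iso.symm_hom, Iso.symm_inv, whiskerRightIso_hom,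
    whiskerRightIso_inv, Category.assoc] at e1 e2
  have h3 : g ▷ Wᘁ = (β_ (W ⊗ Y) (Wᘁ)).hom ≫ Wᘁ ◁ g ≫ (β_ (W ⊗ Y) (Wᘁ)).inv := by
    rw [← BraidedCategory.braiding_naturality_left_assoc]; simp
  have h4 : (β_ W (Wᘁ)).inv ≫ evL W = (twist (Wᘁ)).hom ▷ W ≫ evR W := by
    rw [RibbonCategory.twist_dual, evR_mate, evL,
      BraidedCategory.braiding_naturality_left_assoc, Iso.inv_hom_id_assoc]
  have h5 : coevL W = coevR W ≫ (β_ W (Wᘁ)).hom ≫ (twist (Wᘁ)).hom ▷ W := by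
    rw [← BraidedCategory.braiding_naturality_right, ← Category.assoc, coevR_twist_dual,
      Category.assoc, BraidedCategory.braiding_naturality_left, coevL_eq]
  have h6 : (λ_ Y).inv ≫ coevR W ▷ Y = (ρ_ Y).inv ≫ Y ◁ coevR W ≫ (β_ Y (W ⊗ Wᘁ)).hom := by
    rw [BraidedCategory.braiding_naturality_right]; simp
  have h7 : evL W ▷ Y ≫ (λ_ Y).hom = (β_ Y (W ⊗ Wᘁ)).inv ≫ Y ◁ evL W ≫ (ρ_ Y).hom := by
    rw [← BraidedCategory.braiding_inv_naturality_left_assoc]; simp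
  have h8 : Wᘁ ◁ g ≫ (α_ _ _ _).inv ≫ (twist (Wᘁ)).hom ▷ W ▷ Y =
      (twist (Wᘁ)).hom ▷ (W ⊗ Y) ≫ Wᘁ ◁ g ≫ (α_ _ _ _).inv := by
    rw [← associator_inv_naturality_left, whisker_exchange_assoc]
  simp only [ptr, comp_whiskerRight, Category.assoc]
  rw [h3]
  simp only [Category.assoc]
  rw [reassoc_of% e1, reassoc_of% e2, ← h7, ← reassoc_of% h6, ← comp_whiskerRight_assoc _ (evL W),
    h4, ptrLeft, h5]
  simp only [comp_whiskerRight, Category.assoc]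
  rw [reassoc_of% h8, ← associator_naturality_left_assoc]

/-! ### Epimorphisms and projectivity under tensor products -/

lemma epi_whiskerLeft (A : C) {X Y : C} (f : X ⟶ Y) [Epi f] : Epi (A ◁ f) := by
  have : (tensorLeft A).PreservesEpimorphisms :=
    Functor.preservesEpimorphisms_of_adjunction (@tensorLeftAdjunction _ _ _ (Aᘁ) A (leftPairing A))
  exact inferInstanceAs (Epi ((tensorLeft A).map f))

lemma epi_whiskerRight (A : C) {X Y : C} (f : X ⟶ Y) [Epi f] : Epi (f ▷ A) := by
  have : (tensorRight A).PreservesEpimorphisms :=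
    Functor.preservesEpimorphisms_of_adjunction (tensorRightAdjunction A (Aᘁ))
  exact inferInstanceAs (Epi ((tensorRight A).map f))

lemma epi_evL {V : C} (hV : IsRegularObj V) : Epi (evL V) := by
  have : Epi (evR V) := hV
  rw [evL]
  infer_instance

/-- Projectivity, as a class with instances for tensor products only. -/
class ProjObj (A : C) : Prop where
  out : Projective A

instance projObj_tensor_left (A B : C) [hA : ProjObj A] : ProjObj (A ⊗ B) :=
  ⟨(projIdeal C).tensor_mem hA.out B⟩

instance projObj_tensor_right (A B : C) [hA : ProjObj A] : ProjObj (B ⊗ A) :=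
  ⟨Projective.of_iso (β_ A B) ((projIdeal C).tensor_mem hA.out B)⟩

end RibbonCalculus

section Linear

variable {𝕜 : Type*} [Field 𝕜] {C : Type u} [Category.{v} C] [Preadditive C]
  [Linear 𝕜 C] [MonoidalCategory C] [MonoidalPreadditive C] [MonoidalLinear 𝕜 C]
  [BraidedCategory C] [RightRigidCategory C] [RibbonCategory C]

/-! ### Dominating families -/

section Family

variable {J : Type*} {D : J → C} {P : ObjectProperty C}

/-- A family of nonzero objects with scalar endomorphisms and without morphisms between
different members. -/
structure IsSchurFamily (𝕜 : Type*) [Field 𝕜] {C : Type u} [Category.{v} C] [Preadditive C]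
    [Linear 𝕜 C] {J : Type*} (D : J → C) : Prop where
  eq_zero : ∀ {i j : J}, i ≠ j → ∀ f : D i ⟶ D j, f = 0
  id_ne_zero : ∀ i, 𝟙 (D i) ≠ 0
  exists_scalar : ∀ (i : J) (f : D i ⟶ D i), ∃ c : 𝕜, f = c • 𝟙 (D i)

lemma IsCompletelyReduced.isSchurFamily (h : IsCompletelyReduced 𝕜 D) : IsSchurFamily 𝕜 D := by
  have hid : ∀ i, 𝟙 (D i) ≠ 0 := by
    intro i h0
    have := h i i
    rw [if_pos rfl] at this
    have hs : Subsingleton (D i ⟶ D i) :=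
      ⟨fun a b => by rw [← Category.comp_id a, ← Category.comp_id b, h0]; simp⟩
    rw [rank_zero_iff.2 hs] at this
    exact zero_ne_one this
  refine ⟨fun {i j} hij f => ?_, hid, fun i f => ?_⟩
  · have := h i j
    rw [if_neg hij, rank_zero_iff] at this
    exact Subsingleton.elim _ _
  · have h1 := h i i
    rw [if_pos rfl] at h1
    obtain ⟨c, hc⟩ := exists_smul_eq_of_finrank_eq_one (Module.rank_eq_one_iff_finrank_eq_one.1 h1)
      (hid i) f
    exact ⟨c, hc.symm⟩

/-- Nonzero morphisms to a member of the family are split epimorphisms. -/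
lemma IsDominating.exists_section (hD : IsDominating P D) (h : IsSchurFamily 𝕜 D) {Q : C}
    (hQ : P Q) {j : J} {f : Q ⟶ D j} (hf : f ≠ 0) : ∃ u : D j ⟶ Q, u ≫ f = 𝟙 (D j) := by
  obtain ⟨m, a, ι, s, hs⟩ := hD.2 Q hQ
  have : ∃ k, ι k ≫ f ≠ 0 := by
    by_contra! hk
    apply hf
    rw [← Category.id_comp f, hs, Preadditive.sum_comp]
    exact Finset.sum_eq_zero fun k _ => by rw [Category.assoc, hk, Limits.comp_zero]
  obtain ⟨k, hk⟩ := this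
  have hkj : a k = j := by
    by_contra hne
    exact hk (h.eq_zero hne _)
  subst hkj
  obtain ⟨c, hc⟩ := h.exists_scalar _ (ι k ≫ f)
  have hc0 : c ≠ 0 := by
    rintro rfl
    exact hk (by rw [hc, zero_smul])
  exact ⟨c⁻¹ • ι k, by rw [Linear.smul_comp, hc, smul_smul, inv_mul_cancel₀ hc0, one_smul]⟩

lemma IsDominating.projObj (hD : IsDominating P D) (hp : ∀ j, ProjObj (D j)) {Q : C}
    (hQ : P Q) : ProjObj Q := by
  obtain ⟨m, a, ι, s, hs⟩ := hD.2 Q hQ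
  have := fun j => (hp j).out
  refine ⟨⟨fun {E X} f e _ => ⟨∑ k, s k ≫ Projective.factorThru (ι k ≫ f) e, ?_⟩⟩⟩
  rw [Preadditive.sum_comp]
  simp only [Category.assoc, Projective.factorThru_comp]
  simp only [← Category.assoc, ← Preadditive.sum_comp, ← hs, Category.id_comp]

end Family

/-- If `r` dies after tensoring with `V`, it dies after tensoring with `Vᘁ ⊗ V`, which maps
epimorphically to `𝟙`. -/
lemma eq_zero_of_whiskerRight_regular {V : C} (hV : IsRegularObj V) {A : C} {r : A ⟶ 𝟙_ C}
    (h : r ▷ V = 0) : r = 0 := by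
  have : Epi (evR V) := hV
  have : Epi (A ◁ evR V) := epi_whiskerLeft _ _
  have h1 : r ▷ (V ⊗ Vᘁ) = 0 := by simp [h]
  have h2 : r ▷ (Vᘁ ⊗ V) = 0 := by
    rw [← cancel_mono (_ ◁ (β_ (Vᘁ) V).hom), ← whisker_exchange, h1]; simp
  have h3 : r ▷ 𝟙_ C = 0 := by
    rw [← cancel_epi (A ◁ evR V), whisker_exchange, h2]; simp
  simpa using h3

lemma evL_ne_zero {V : C} (hV : 𝟙 V ≠ 0) : evL V ≠ 0 := by
  intro h
  apply hV
  rw [← ptr_evL_coevR, h]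
  simp [ptr]

/-! ### Modified traces -/

namespace MTrace

variable (t : MTrace 𝕜 (projIdeal C))

/-- The modified trace of an endomorphism of a projective object. -/
def T (A : C) [hA : ProjObj A] : (A ⟶ A) →ₗ[𝕜] 𝕜 := t.tr A hA.out

lemma T_cyclic {A B : C} [ProjObj A] [ProjObj B] (f : A ⟶ B) (g : B ⟶ A) :
    t.T A (f ≫ g) = t.T B (g ≫ f) := t.cyclic _ _ f g

lemma T_conj {A B : C} [ProjObj A] [ProjObj B] (e : A ≅ B) (f : A ⟶ A) :
    t.T B (e.inv ≫ f ≫ e.hom) = t.T A f := by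
  rw [t.T_cyclic, Category.assoc, e.hom_inv_id, Category.comp_id]

lemma T_ptr {A B : C} [hA : ProjObj A] (f : A ⊗ B ⟶ A ⊗ B) : t.T (A ⊗ B) f = t.T A (ptr f) :=
  t.partial_trace hA.out f

lemma T_ptrLeft {A B : C} [ProjObj A] (f : B ⊗ A ⟶ B ⊗ A) :
    t.T (B ⊗ A) f = t.T A (ptrLeft f) := by
  rw [← ptr_braiding_conj, ← T_ptr, ← t.T_conj (β_ A B).symm]
  simp

/-- The morphism `evL U ≫ coevR U` of `U ⊗ Uᘁ` straightens to an identity under either partial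
trace. -/
lemma T_dual {U : C} [ProjObj U] [ProjObj (Uᘁ)] : t.T (Uᘁ) (𝟙 _) = t.T U (𝟙 _) := by
  rw [← ptrLeft_evL_coevR, ← T_ptrLeft, T_ptr, ptr_evL_coevR]

lemma dim_eq (A : C) [hA : ProjObj A] : t.dim A = t.T A (𝟙 A) := dif_pos hA.out

/-- Sandwiching `u` between two decompositions of `𝟙 A` leaves blocks between members of the family.
Each is zero or, up to an identification, a scalar, and that scalar is detected by the trace. -/
lemma T_nondegenerate {J : Type*} {D : J → C} {P : ObjectProperty C} (hD : IsDominating P D)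
    (h : IsSchurFamily 𝕜 D) [hp : ∀ j, ProjObj (D j)] (ht : ∀ j, t.T (D j) (𝟙 _) ≠ 0)
    {A : C} [ProjObj A] (hA : P A) (u : A ⟶ A) (hu : ∀ z : A ⟶ A, t.T A (u ≫ z) = 0) :
    u = 0 := by
  obtain ⟨m, a, ι, s, hs⟩ := hD.2 A hA
  have key : ∀ k l, ι k ≫ u ≫ s l = 0 := by
    intro k l
    by_cases hkl : a k = a l
    · obtain ⟨c, hc⟩ := h.exists_scalar (a k) ((ι k ≫ u ≫ s l) ≫ eqToHom (by rw [hkl]))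
      have h0 : c * t.T (D (a k)) (𝟙 _) = 0 := by
        rw [← smul_eq_mul, ← map_smul, ← hc, Category.assoc, T_cyclic, Category.assoc,
          Category.assoc]
        exact hu _
      have hc0 := (mul_eq_zero.1 h0).resolve_right (ht _)
      rw [hc0, zero_smul] at hc
      rw [← cancel_mono (eqToHom (show D (a l) = D (a k) by rw [hkl])), hc]
      simp
    · exact h.eq_zero hkl _
  have : u = 𝟙 A ≫ u ≫ 𝟙 A := by simp
  rw [this, hs]
  simp only [Preadditive.sum_comp, Preadditive.comp_sum, Category.assoc]
  refine Finset.sum_eq_zero fun k _ => Finset.sum_eq_zero fun l _ => ?_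
  rw [reassoc_of% (key l k)]
  simp

end MTrace

section Mate

lemma rightAdjointMate_smul {A B : C} (c : 𝕜) (f : A ⟶ B) :
    rightAdjointMate (c • f) = c • rightAdjointMate f := by
  simp [rightAdjointMate]

lemma rightAdjointMate_add {A B : C} (f g : A ⟶ B) :
    rightAdjointMate (f + g) = rightAdjointMate f + rightAdjointMate g := by
  simp [rightAdjointMate]

lemma rightAdjointMate_sum {A B : C} {J : Type*} (s : Finset J) (f : J → (A ⟶ B)) :
    rightAdjointMate (∑ i ∈ s, f i) = ∑ i ∈ s, rightAdjointMate (f i) :=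
  map_sum (AddMonoidHom.mk' (fun f : A ⟶ B => rightAdjointMate f) rightAdjointMate_add) f s

lemma rightAdjointMate_injective {A B : C} {f g : A ⟶ B}
    (h : rightAdjointMate f = rightAdjointMate g) : f = g := by
  have h1 : coevR A ≫ f ▷ Aᘁ = coevR A ≫ g ▷ Aᘁ := by rw [← coevR_mate, ← coevR_mate, h]
  have h2 : ∀ f : A ⟶ B, f = (λ_ A).inv ≫ (coevR A ≫ f ▷ Aᘁ) ▷ A ≫ (α_ _ _ _).hom ≫
      B ◁ evR A ≫ (ρ_ B).hom := by
    intro f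
    have := evR_coevR A
    simp only [comp_whiskerRight, Category.assoc, associator_naturality_left_assoc]
    rw [← whisker_exchange_assoc, reassoc_of% this]
    simp
  rw [h2 f, h2 g, h1]

end Mate

/-! ### Invertible objects and the free realisation -/

section Invertible

/-- Tensoring with an invertible object is an equivalence. -/
noncomputable def tensorLeftEquivalence {A B : C} (j : A ⊗ B ≅ 𝟙_ C) : C ≌ C :=
  CategoryTheory.Equivalence.mk (tensorLeft B) (tensorLeft A)
    ((leftUnitorNatIso C).symm ≪≫ (tensoringLeft C).mapIso j.symm ≪≫ tensorLeftTensor A B)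
    ((tensorLeftTensor B A).symm ≪≫ (tensoringLeft C).mapIso (β_ B A ≪≫ j) ≪≫ leftUnitorNatIso C)

/-- Tensoring with `B` and tensoring with `Aᘁ` are both left adjoint to tensoring with `A`; evaluate
at the unit. -/
lemma nonempty_dual_iso {A B : C} (j : A ⊗ B ≅ 𝟙_ C) : Nonempty (B ≅ Aᘁ) :=
  ⟨(ρ_ B).symm ≪≫ (Adjunction.leftAdjointUniq (tensorLeftEquivalence j).toAdjunction
    (tensorLeftAdjunction A (Aᘁ))).app (𝟙_ C) ≪≫ ρ_ (Aᘁ)⟩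

end Invertible

section Unit

variable [LinearRibbonCategory 𝕜 C]

lemma unit_exists_scalar (f : 𝟙_ C ⟶ 𝟙_ C) : ∃ c : 𝕜, f = c • 𝟙 (𝟙_ C) := by
  obtain ⟨c, hc⟩ := (LinearRibbonCategory.unit_bijective (𝕜 := 𝕜) (C := C)).2 f
  exact ⟨c, hc.symm⟩

end Unit

namespace FreeRealisation

variable {Z : Type*} [AddCommGroup Z] (σ : FreeRealisation 𝕜 C Z)

open Classical in
/-- The quantum dimension `±1` of `σ(k)`. -/
noncomputable def sign (k : Z) : 𝕜 :=
  if coevR (σ.obj k) ≫ evL (σ.obj k) = 𝟙 (𝟙_ C) then 1 else -1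

lemma sign_spec (k : Z) : coevR (σ.obj k) ≫ evL (σ.obj k) = σ.sign k • 𝟙 (𝟙_ C) := by
  unfold sign
  split_ifs with h
  · rw [h, one_smul]
  · rw [(σ.qdim k).resolve_left h, neg_smul, one_smul]

lemma sign_mul_self (k : Z) : σ.sign k * σ.sign k = 1 := by
  unfold sign
  split_ifs <;> simp

lemma sign_ne_zero (k : Z) : σ.sign k ≠ 0 := by
  intro h
  have := σ.sign_mul_self k
  simp [h] at this

lemma T_whiskerRight (t : MTrace 𝕜 (projIdeal C)) {A : C} [ProjObj A] (k : Z) (f : A ⟶ A) :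
    t.T (A ⊗ σ.obj k) (f ▷ σ.obj k) = σ.sign k * t.T A f := by
  have h := ptr_comp_whiskerRight (𝟙 (A ⊗ σ.obj k)) f
  rw [Category.id_comp, ptr_id, σ.sign_spec] at h
  rw [t.T_ptr, h]
  simp

/-- `σ(k) ⊗ σ(l) ≅ 𝟙` if `k + l = 0`. -/
lemma nonempty_iso_unit {k l : Z} (h : k + l = 0) : Nonempty (σ.obj k ⊗ σ.obj l ≅ 𝟙_ C) := by
  obtain ⟨e⟩ := σ.add_iso k l
  obtain ⟨e'⟩ := σ.zero_iso
  rw [h] at e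
  exact ⟨e ≪≫ e'⟩

lemma nonempty_dual_iso {k l : Z} (h : k + l = 0) : Nonempty (σ.obj l ≅ (σ.obj k)ᘁ) := by
  obtain ⟨e⟩ := σ.nonempty_iso_unit h
  exact RelMod.nonempty_dual_iso e

variable [LinearRibbonCategory 𝕜 C]

/-- Up to `e`, the morphism `a` is a scalar endomorphism of the unit, and it is nonzero because `a ≫
b` is. -/
lemma isIso_of_unit {X : C} (e : X ≅ 𝟙_ C) {a : 𝟙_ C ⟶ X} {b : X ⟶ 𝟙_ C} {c : 𝕜} (hc : c ≠ 0)
    (h : a ≫ b = c • 𝟙 _) : IsIso a := by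
  obtain ⟨c', hcc⟩ := unit_exists_scalar (𝕜 := 𝕜) (a ≫ e.hom)
  have hc0 : c' ≠ 0 := by
    rintro rfl
    rw [zero_smul] at hcc
    have ha : a = 0 := by rw [← cancel_mono e.hom, hcc]; simp
    rw [ha, Limits.zero_comp] at h
    have h1 : (fun a : 𝕜 => a • 𝟙 (𝟙_ C)) c = (fun a : 𝕜 => a • 𝟙 (𝟙_ C)) 0 := by
      simpa using h.symm
    exact hc ((LinearRibbonCategory.unit_bijective (𝕜 := 𝕜) (C := C)).1 h1)
  refine ⟨c'⁻¹ • e.hom, ?_, ?_⟩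
  · rw [Linear.comp_smul, hcc, smul_smul, inv_mul_cancel₀ hc0, one_smul]
  · rw [← cancel_epi e.inv, ← cancel_mono e.hom]
    simp [hcc, hc0]

/-- `σ(k)` and `σ(l)` with `k + l = 0` are inverse to each other, by isomorphisms that satisfy
a zigzag identity. -/
lemma exists_zigzag {k l : Z} (h : k + l = 0) :
    ∃ (j₀ : 𝟙_ C ≅ σ.obj k ⊗ σ.obj l) (j₁ : σ.obj l ⊗ σ.obj k ≅ 𝟙_ C),
      j₀.hom ▷ σ.obj k ≫ (α_ _ _ _).hom ≫ σ.obj k ◁ j₁.hom = (λ_ _).hom ≫ (ρ_ _).inv := by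
  obtain ⟨e⟩ := σ.nonempty_dual_iso h
  obtain ⟨e1⟩ := σ.nonempty_iso_unit h
  -- The quantum dimension is `±1`, so the duality morphisms of `σ(k)` are themselves invertible;
  -- they give the required pair.
  have : IsIso (coevR (σ.obj k)) :=
    isIso_of_unit (whiskerLeftIso _ e.symm ≪≫ e1) (σ.sign_ne_zero k) (σ.sign_spec k)
  have : IsIso (evR (σ.obj k)) := by
    have h1 : evR (σ.obj k) = (β_ (σ.obj k) ((σ.obj k)ᘁ)).inv ≫ evL (σ.obj k) := by
      rw [evL, σ.twist_eq]
      simp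
    have h2 : evL (σ.obj k) = inv (coevR (σ.obj k)) ≫ (σ.sign k • 𝟙 _) := by
      rw [← σ.sign_spec k]; simp
    have h3 : IsIso (σ.sign k • 𝟙 (𝟙_ C)) :=
      ⟨σ.sign k • 𝟙 (𝟙_ C), by simp [smul_smul, σ.sign_mul_self],
        by simp [smul_smul, σ.sign_mul_self]⟩
    rw [h1, h2]; infer_instance
  refine ⟨asIso (coevR (σ.obj k)) ≪≫ whiskerLeftIso _ e.symm,
    whiskerRightIso e _ ≪≫ asIso (evR (σ.obj k)), ?_⟩
  have := evR_coevR (σ.obj k)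
  simp only [Iso.trans_hom, asIso_hom, whiskerLeftIso_hom, whiskerRightIso_hom, Iso.symm_hom,
    comp_whiskerRight, Category.assoc, MonoidalCategory.whiskerLeft_comp]
  rw [← this]
  simp

end FreeRealisation

/-! ### Projectivity and nonvanishing modified dimensions in generic degrees -/

namespace RelPreModular

variable [LinearRibbonCategory 𝕜 C] {G : Type*} [AddCommGroup G] {Z : Type*} [AddCommGroup Z]
  {X : Set G} (M : RelPreModular 𝕜 C G Z X)

/-- The family `V_i ⊗ σ(k)`. -/
abbrev fam (g : G) (p : Fin (M.card g) × Z) : C := M.V g p.1 ⊗ M.σ.obj p.2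

lemma isSchurFamily_fam {g : G} (hg : g ∉ X) : IsSchurFamily 𝕜 (M.fam g) :=
  (M.completely_reduced g hg).isSchurFamily

/-- `V_i ≅ V_i ⊗ σ(0)`. -/
lemma nonempty_fam_zero_iso (A : C) : Nonempty (A ⊗ M.σ.obj 0 ≅ A) := by
  obtain ⟨e⟩ := M.σ.zero_iso
  exact ⟨whiskerLeftIso _ e ≪≫ ρ_ _⟩

lemma V_id_ne_zero {g : G} (hg : g ∉ X) (i : Fin (M.card g)) : 𝟙 (M.V g i) ≠ 0 := by
  intro h
  refine (M.isSchurFamily_fam hg).id_ne_zero (i, 0) ?_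
  rw [← id_whiskerRight, h]
  simp

lemma V_exists_scalar {g : G} (hg : g ∉ X) (i : Fin (M.card g)) (f : M.V g i ⟶ M.V g i) :
    ∃ c : 𝕜, f = c • 𝟙 _ := by
  obtain ⟨c, hc⟩ := (M.V_simple g hg i).2 f
  exact ⟨c, hc.symm⟩

lemma exists_homogeneous_projObj :
    ∃ (h : G) (P : C), M.grading.deg h P ∧ ProjObj P ∧ 𝟙 P ≠ 0 := by
  obtain ⟨V, hV, f, hf⟩ := M.t_ne_zero
  obtain ⟨s, Y, hY, ι, π, h1, h2, h3⟩ := M.grading.exists_decomposition V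
  have : ∃ g ∈ s, 𝟙 (Y g) ≠ 0 := by
    by_contra! hs
    apply hf
    have h0 : 𝟙 V = 0 := by
      rw [← h3]
      refine Finset.sum_eq_zero fun g hg => ?_
      rw [← Category.id_comp (ι g), hs g hg]
      simp
    rw [← Category.id_comp f, h0]
    simp
  obtain ⟨g, hg, hne⟩ := this
  exact ⟨g, Y g, hY g hg, ⟨(projIdeal C).retract_mem (ι g) (π g) hV (h1 g hg)⟩, hne⟩

lemma deg_cast {g h : G} {A : C} (hA : M.grading.deg g A) (e : g = h) : M.grading.deg h A := e ▸ hA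

/-- Regularity keeps the map `P ⊗ Pᘁ ⊗ V_i ⟶ V_i` nonzero for a nonzero homogeneous projective `P`.
A nonzero map onto a member of the family splits, so `V_i` is a retract of a projective. -/
lemma projObj_V {g : G} (hg : g ∉ X) (i : Fin (M.card g)) : ProjObj (M.V g i) := by
  obtain ⟨h, P, hP, hpP, hne⟩ := M.exists_homogeneous_projObj
  obtain ⟨e⟩ := M.nonempty_fam_zero_iso (M.V g i)
  have hQ : M.grading.deg g (P ⊗ Pᘁ ⊗ M.V g i) :=
    M.deg_cast (M.grading.tensor_mem hP
      (M.grading.tensor_mem (M.grading.dual_mem hP) (M.V_mem g hg i))) (by abel)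
  obtain ⟨f, hf⟩ : ∃ f : P ⊗ Pᘁ ⊗ M.V g i ⟶ M.fam g (i, 0), f ≠ 0 := by
    refine ⟨(α_ _ _ _).inv ≫ evL P ▷ M.V g i ≫ (λ_ _).hom ≫ e.inv, fun h0 => ?_⟩
    refine evL_ne_zero hne (eq_zero_of_whiskerRight_regular (M.V_regular g hg i) ?_)
    rw [← cancel_epi (α_ _ _ _).inv, ← cancel_mono ((λ_ _).hom ≫ e.inv), Category.assoc, h0]
    simp
  obtain ⟨u, hu⟩ := (M.dominating g hg).exists_section (M.isSchurFamily_fam hg) hQ hf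
  have hpQ : ProjObj (P ⊗ Pᘁ ⊗ M.V g i) := inferInstance
  exact ⟨(projIdeal C).retract_mem (e.inv ≫ u) (f ≫ e.hom) hpQ.out (by
    rw [Category.assoc, reassoc_of% hu, e.inv_hom_id])⟩

lemma projObj_of_deg {g : G} (hg : g ∉ X) {A : C} (hA : M.grading.deg g A) : ProjObj A :=
  (M.dominating g hg).projObj (fun p => by
    have := M.projObj_V hg p.1
    infer_instance) hA

lemma neg_notMem (M : RelPreModular 𝕜 C G Z X) {g : G} (hg : g ∉ X) : -g ∉ X := by
  intro h
  apply hg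
  rw [M.symmetric]
  exact ⟨-g, h, neg_neg g⟩

/-- Regularity makes every projective `P` a retract of `P ⊗ Vᘁ ⊗ V`. Every trace on `P` therefore
reduces to the trace of a scalar on `V`, and the m-trace would vanish if `d(V)` did. -/
lemma T_V_ne_zero {g : G} (hg : g ∉ X) (i : Fin (M.card g)) [ProjObj (M.V g i)] :
    M.t.T (M.V g i) (𝟙 _) ≠ 0 := by
  obtain ⟨P, hP, f, hf⟩ := M.t_ne_zero
  have hP' : ProjObj P := ⟨hP⟩
  have hP₂ : Projective P := hP
  intro h0
  apply hf
  set V := M.V g i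
  have : Epi (evR V) := M.V_regular g hg i
  have : Epi (P ◁ evR V) := epi_whiskerLeft _ _
  let u := Projective.factorThru (𝟙 P) (P ◁ evR V ≫ (ρ_ P).hom)
  have hu : u ≫ P ◁ evR V ≫ (ρ_ P).hom = 𝟙 P := Projective.factorThru_comp _ _
  have h1 : M.t.T P f = M.t.T (P ⊗ Vᘁ ⊗ V) ((P ◁ evR V ≫ (ρ_ P).hom ≫ f) ≫ u) := by
    rw [M.t.T_cyclic, reassoc_of% hu]
  change M.t.T P f = 0
  rw [h1, ← M.t.T_conj ((α_ P (Vᘁ) V).symm ≪≫ β_ (P ⊗ Vᘁ) V), M.t.T_ptr]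
  obtain ⟨c, hc⟩ := M.V_exists_scalar hg i (ptr (((α_ P (Vᘁ) V).symm ≪≫ β_ (P ⊗ Vᘁ) V).inv ≫
    ((P ◁ evR V ≫ (ρ_ P).hom ≫ f) ≫ u) ≫ ((α_ P (Vᘁ) V).symm ≪≫ β_ (P ⊗ Vᘁ) V).hom))
  rw [hc, map_smul, h0, smul_zero]

lemma d_eq {g : G} (i : Fin (M.card g)) [ProjObj (M.V g i)] :
    M.d g i = M.t.T (M.V g i) (𝟙 _) := M.t.dim_eq _

lemma d_ne_zero {g : G} (hg : g ∉ X) (i : Fin (M.card g)) : M.d g i ≠ 0 := by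
  have := M.projObj_V hg i
  rw [M.d_eq]
  exact M.T_V_ne_zero hg i

lemma T_id_tensor_σ {A : C} [ProjObj A] (k : Z) :
    M.t.T (A ⊗ M.σ.obj k) (𝟙 _) = M.σ.sign k * M.t.T A (𝟙 _) := by
  rw [← M.σ.T_whiskerRight, id_whiskerRight]

lemma T_nondegenerate {g : G} (hg : g ∉ X) {A : C} (hA : M.grading.deg g A) [ProjObj A]
    (u : A ⟶ A) (hu : ∀ z : A ⟶ A, M.t.T A (u ≫ z) = 0) : u = 0 := by
  have := M.projObj_V hg
  refine M.t.T_nondegenerate (M.dominating g hg) (M.isSchurFamily_fam hg) (fun p => ?_) hA u hu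
  rw [M.T_id_tensor_σ]
  exact mul_ne_zero (M.σ.sign_ne_zero _) (M.T_V_ne_zero hg _)

end RelPreModular

/-! ### Duals of the dominating families -/

section DualFamily

lemma IsSchurFamily.dual {J J' : Type*} {D : J → C} (h : IsSchurFamily 𝕜 D) {D' : J' → C}
    (φ : J' → J) (hφ : Function.Injective φ) (e : ∀ j, D' j ≅ (D (φ j))ᘁ) :
    IsSchurFamily 𝕜 D' := by
  have mate_zero : ∀ A B : C, rightAdjointMate (0 : A ⟶ B) = 0 := fun A B => by
    simp [rightAdjointMate]
  refine ⟨fun {i j} hij f => ?_, fun j h0 => ?_, fun j f => ?_⟩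
  · have h1 := h.eq_zero (fun h' => hij (hφ h').symm) ((doubleDualIso _).hom ≫
      rightAdjointMate ((e i).inv ≫ f ≫ (e j).hom) ≫ (doubleDualIso _).inv)
    have h2 : rightAdjointMate ((e i).inv ≫ f ≫ (e j).hom) = rightAdjointMate 0 := by
      rw [← cancel_epi (doubleDualIso _).hom, ← cancel_mono (doubleDualIso _).inv,
        Category.assoc, h1, mate_zero]
      simp
    rw [← cancel_epi (e i).inv, ← cancel_mono (e j).hom, Category.assoc,
      rightAdjointMate_injective h2]
    simp
  · refine h.id_ne_zero (φ j) (rightAdjointMate_injective ?_)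
    rw [rightAdjointMate_id, mate_zero, ← cancel_epi (e j).hom, ← Category.id_comp (e j).hom, h0]
    simp
  · obtain ⟨c, hc⟩ := h.exists_scalar (φ j) ((doubleDualIso _).hom ≫
      rightAdjointMate ((e j).inv ≫ f ≫ (e j).hom) ≫ (doubleDualIso _).inv)
    have h2 : rightAdjointMate ((e j).inv ≫ f ≫ (e j).hom) = rightAdjointMate (c • 𝟙 _) := by
      rw [← cancel_epi (doubleDualIso _).hom, ← cancel_mono (doubleDualIso _).inv,
        Category.assoc, hc, rightAdjointMate_smul, rightAdjointMate_id]
      simp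
    refine ⟨c, ?_⟩
    rw [← cancel_epi (e j).inv, ← cancel_mono (e j).hom, Category.assoc,
      rightAdjointMate_injective h2]
    simp

lemma IsDominating.dual {J J' : Type*} {D : J → C} {P P' : ObjectProperty C}
    (h : IsDominating P D) (hP : ∀ A, P' A → P (Aᘁ)) {D' : J' → C} (hD' : ∀ j, P' (D' j))
    (φ : J → J') (e : ∀ j, D' (φ j) ≅ (D j)ᘁ) : IsDominating P' D' := by
  refine ⟨hD', fun A hA => ?_⟩
  obtain ⟨m, a, ι, s, hs⟩ := h.2 (Aᘁ) (hP A hA)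
  refine ⟨m, fun k => φ (a k),
    fun k => (e (a k)).hom ≫ rightAdjointMate (s k) ≫ (doubleDualIso A).inv,
    fun k => (doubleDualIso A).hom ≫ rightAdjointMate (ι k) ≫ (e (a k)).inv, ?_⟩
  have h1 := congrArg (fun f => rightAdjointMate f) hs
  simp only [rightAdjointMate_id, rightAdjointMate_sum, comp_rightAdjointMate] at h1
  simp only [Category.assoc, Iso.inv_hom_id_assoc]
  have h2 : 𝟙 A = (doubleDualIso A).hom ≫ 𝟙 _ ≫ (doubleDualIso A).inv := by simp
  rw [h2, h1]
  simp only [Preadditive.sum_comp, Preadditive.comp_sum, Category.assoc]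

end DualFamily

namespace RelPreModular

variable [LinearRibbonCategory 𝕜 C] {G : Type*} [AddCommGroup G] {Z : Type*} [AddCommGroup Z]
  {X : Set G} (M : RelPreModular 𝕜 C G Z X)

/-- The family `V_iᘁ ⊗ σ(k)`. -/
abbrev dualFam (g : G) (p : Fin (M.card g) × Z) : C := (M.V g p.1)ᘁ ⊗ M.σ.obj p.2

lemma nonempty_dualFam_iso (g : G) (i : Fin (M.card g)) {k l : Z} (h : k + l = 0) :
    Nonempty (M.dualFam g (i, l) ≅ (M.fam g (i, k))ᘁ) := by
  obtain ⟨e⟩ := M.σ.nonempty_dual_iso h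
  exact ⟨whiskerLeftIso _ e ≪≫ β_ _ _ ≪≫ (rightDualTensorIso _ _).symm⟩

/-- The reversed circles carry the colours `V_iᘁ`, so decompositions in degree `-g` must use these
duals and not the family chosen for `-g`. -/
lemma dualFam_dominating {g : G} (hg : g ∉ X) :
    IsDominating (M.grading.deg (-g)) (M.dualFam g) := by
  refine (M.dominating g hg).dual (fun A hA => M.deg_cast (M.grading.dual_mem hA) (neg_neg g))
    (fun p => M.deg_cast (M.grading.tensor_mem (M.grading.dual_mem (M.V_mem g hg p.1))
      (M.σ_mem p.2)) (add_zero _)) (fun p => (p.1, -p.2)) fun p => ?_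
  exact (M.nonempty_dualFam_iso g p.1 (add_neg_cancel p.2)).some

lemma isSchurFamily_dualFam {g : G} (hg : g ∉ X) : IsSchurFamily 𝕜 (M.dualFam g) := by
  refine (M.isSchurFamily_fam hg).dual (fun p => (p.1, -p.2)) ?_ fun p => ?_
  · rintro ⟨i, k⟩ ⟨j, l⟩ h
    simpa using h
  · exact (M.nonempty_dualFam_iso g p.1 (neg_add_cancel p.2)).some

lemma dual_mem {g : G} (hg : g ∉ X) (i : Fin (M.card g)) :
    M.grading.deg (-g) ((M.V g i)ᘁ) := M.grading.dual_mem (M.V_mem g hg i)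

lemma projObj_dual {g : G} (hg : g ∉ X) (i : Fin (M.card g)) : ProjObj ((M.V g i)ᘁ) :=
  M.projObj_of_deg (M.neg_notMem hg) (M.dual_mem hg i)

lemma T_dual {g : G} (hg : g ∉ X) (i : Fin (M.card g)) [ProjObj ((M.V g i)ᘁ)] :
    M.t.T ((M.V g i)ᘁ) (𝟙 _) = M.d g i := by
  have := M.projObj_V hg i
  rw [M.t.T_dual, M.d_eq]

/-- Up to powers of `σ`, there are no morphisms between different duals. -/
lemma dual_hom_eq_zero {g : G} (hg : g ∉ X) {i j : Fin (M.card g)} {k : Z}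
    (h : ¬ (i = j ∧ k = 0)) {S : C} (e : S ≅ M.σ.obj k)
    (f : (M.V g i)ᘁ ⟶ (M.V g j)ᘁ ⊗ S) : f = 0 := by
  obtain ⟨e0⟩ := M.nonempty_fam_zero_iso ((M.V g i)ᘁ)
  have := (M.isSchurFamily_dualFam hg).eq_zero (i := (i, 0)) (j := (j, k))
    (fun h' => h (by simp only [Prod.mk.injEq] at h'; exact ⟨h'.1, h'.2.symm⟩))
    (e0.hom ≫ f ≫ _ ◁ e.hom)
  rw [← cancel_mono (_ ◁ e.hom), ← cancel_epi e0.hom, this]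
  simp

lemma dual_exists_scalar {g : G} (hg : g ∉ X) (i : Fin (M.card g))
    (f : (M.V g i)ᘁ ⟶ (M.V g i)ᘁ) : ∃ c : 𝕜, f = c • 𝟙 _ := by
  obtain ⟨e0⟩ := M.nonempty_fam_zero_iso ((M.V g i)ᘁ)
  obtain ⟨c, hc⟩ := (M.isSchurFamily_dualFam hg).exists_scalar (i, 0) (e0.hom ≫ f ≫ e0.inv)
  refine ⟨c, ?_⟩
  rw [← cancel_mono e0.inv, ← cancel_epi e0.hom, hc]
  simp

/-- Decompositions of identities, sorted by the index in `I_g`. -/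
lemma exists_decomposition {g h : G} (hg : g ∉ X) (hh : h = -g) {A : C} (hA : M.grading.deg h A) :
    ∃ (n : Fin (M.card g) → Type) (_ : ∀ i, Fintype (n i)) (m : ∀ i, n i → Z)
      (s : ∀ i (a : n i), A ⟶ (M.V g i)ᘁ ⊗ M.σ.obj (m i a))
      (ι : ∀ i (a : n i), (M.V g i)ᘁ ⊗ M.σ.obj (m i a) ⟶ A),
      𝟙 A = ∑ i, ∑ a, s i a ≫ ι i a := by
  subst hh
  obtain ⟨N, a, ι, s, hs⟩ := (M.dualFam_dominating hg).2 A hA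
  have e : ∀ i (b : {k : Fin N // (a k).1 = i}),
    M.dualFam g (a b.1) = (M.V g i)ᘁ ⊗ M.σ.obj (a b.1).2 := fun i b => by rw [dualFam, b.2]
  refine ⟨fun i => {k : Fin N // (a k).1 = i}, fun i => inferInstance, fun i b => (a b.1).2,
    fun i b => s b.1 ≫ eqToHom (e i b), fun i b => eqToHom (e i b).symm ≫ ι b.1, ?_⟩
  simp only [Category.assoc, eqToHom_trans_assoc, eqToHom_refl, Category.id_comp]
  rw [hs]
  exact (Fintype.sum_fiberwise (fun k => (a k).1) (fun k => s k ≫ ι k)).symm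

end RelPreModular

/-! ### Bending strands and inserting inverse pairs -/

section Bending

/-- Create a strand `W` and its dual on the left. -/
def cupLeft (W Y : C) : Y ⟶ W ⊗ (Wᘁ ⊗ Y) :=
  (λ_ Y).inv ≫ coevR W ▷ Y ≫ (α_ _ _ _).hom

/-- Annihilate a strand `W` and its dual on the left. -/
def capLeft (W Y : C) : W ⊗ (Wᘁ ⊗ Y) ⟶ Y :=
  (α_ _ _ _).inv ≫ evL W ▷ Y ≫ (λ_ Y).hom

/-- The morphism obtained by bending `W` to the left. -/
def bendLeft {W L Y : C} (s : W ⊗ L ⟶ Y) : L ⟶ Wᘁ ⊗ Y :=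
  (λ_ L).inv ≫ coevL W ▷ L ≫ (α_ _ _ _).hom ≫ Wᘁ ◁ s

lemma bendLeft_capLeft {W L Y : C} (s : W ⊗ L ⟶ Y) : W ◁ bendLeft s ≫ capLeft W Y = s := by
  have h := coevL_evL W
  calc _ = 𝟙 _ ⊗≫ W ◁ coevL W ▷ L ⊗≫ ((W ⊗ Wᘁ) ◁ s ≫ evL W ▷ Y) ⊗≫ 𝟙 _ := by
        simp only [bendLeft, capLeft]; monoidal
    _ = 𝟙 _ ⊗≫ (W ◁ coevL W ≫ (α_ _ _ _).inv ≫ evL W ▷ W) ▷ L ⊗≫ s := by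
        rw [whisker_exchange]; monoidal
    _ = s := by rw [h]; monoidal

lemma ptrLeft_comp_cupLeft {W L Y : C} (s : W ⊗ L ⟶ Y) (a : Wᘁ ⊗ Y ⟶ L) :
    ptrLeft (s ≫ cupLeft W Y ≫ W ◁ a) = bendLeft s ≫ a := by
  have h := coevR_evR W
  calc _ = bendLeft s ⊗≫ Wᘁ ◁ coevR W ▷ Y ⊗≫ ((Wᘁ ⊗ W) ◁ a ≫ evR W ▷ L) ⊗≫ 𝟙 _ := by
        simp only [bendLeft, cupLeft, ptrLeft]; monoidal
    _ = bendLeft s ⊗≫ (Wᘁ ◁ coevR W ≫ (α_ _ _ _).inv ≫ evR W ▷ Wᘁ) ▷ Y ⊗≫ a := by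
        rw [whisker_exchange]; monoidal
    _ = bendLeft s ≫ a := by rw [h]; monoidal

/-- An endomorphism of `V ⊗ W`, acting on `V ⊗ W ⊗ Y`. -/
def extend {V W : C} (x : V ⊗ W ⟶ V ⊗ W) (Y : C) : V ⊗ (W ⊗ Y) ⟶ V ⊗ (W ⊗ Y) :=
  (α_ V W Y).inv ≫ x ▷ Y ≫ (α_ V W Y).hom

lemma extend_naturality {V W : C} (x : V ⊗ W ⟶ V ⊗ W) {Y Y' : C} (s : Y ⟶ Y') :
    V ◁ W ◁ s ≫ extend x Y' = extend x Y ≫ V ◁ W ◁ s := by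
  simp only [extend, Category.assoc]
  rw [associator_inv_naturality_right_assoc, whisker_exchange_assoc, associator_naturality_right]

lemma extend_tensor {V W : C} (x : V ⊗ W ⟶ V ⊗ W) (Y K : C) :
    extend x (Y ⊗ K) = V ◁ (α_ W Y K).inv ≫ (α_ _ _ _).inv ≫ extend x Y ▷ K ≫ (α_ _ _ _).hom ≫
      V ◁ (α_ W Y K).hom := by
  simp only [extend]
  monoidal

lemma ptr_whiskerRight {V W : C} (x : V ⊗ W ⟶ V ⊗ W) (Y : C) :
    ptr x ▷ Y = V ◁ cupLeft W Y ≫ extend x (Wᘁ ⊗ Y) ≫ V ◁ capLeft W Y := by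
  simp only [ptr, cupLeft, capLeft, extend]
  monoidal

variable {κ ν : C} (j₀ : 𝟙_ C ≅ κ ⊗ ν) (j₁ : ν ⊗ κ ≅ 𝟙_ C)

/-- `A ≅ A ⊗ κ ⊗ ν`. -/
def insertPair {κ ν : C} (j₀ : 𝟙_ C ≅ κ ⊗ ν) (A : C) : A ≅ (A ⊗ κ) ⊗ ν :=
  (ρ_ A).symm ≪≫ whiskerLeftIso A j₀ ≪≫ (α_ _ _ _).symm

lemma insertPair_naturality {A B : C} (f : A ⟶ B) :
    f ≫ (insertPair j₀ B).hom = (insertPair j₀ A).hom ≫ f ▷ κ ▷ ν := by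
  simp only [insertPair, Iso.trans_hom, Iso.symm_hom, whiskerLeftIso_hom, Category.assoc]
  rw [rightUnitor_inv_naturality_assoc, ← whisker_exchange_assoc, associator_inv_naturality_left]

lemma insertPair_tensor (W L : C) : (insertPair j₀ (W ⊗ L)).hom ≫ (α_ W L κ).hom ▷ ν =
    W ◁ (insertPair j₀ L).hom ≫ (α_ _ _ _).inv := by
  simp only [insertPair, Iso.trans_hom, Iso.symm_hom, whiskerLeftIso_hom]
  monoidal

lemma insertPair_zigzag
    (h : j₀.hom ▷ κ ≫ (α_ _ _ _).hom ≫ κ ◁ j₁.hom = (λ_ _).hom ≫ (ρ_ _).inv) (A : C) :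
    (insertPair j₀ A).hom ▷ κ = (insertPair j₁.symm (A ⊗ κ)).hom := by
  have h' : j₀.hom ▷ κ = ((λ_ _).hom ≫ (ρ_ _).inv) ≫ κ ◁ j₁.inv ≫ (α_ _ _ _).inv := by
    rw [← h]; simp
  calc _ = 𝟙 _ ⊗≫ A ◁ (j₀.hom ▷ κ) ⊗≫ 𝟙 _ := by
        simp only [insertPair, Iso.trans_hom, Iso.symm_hom, whiskerLeftIso_hom]; monoidal
    _ = _ := by
        rw [h']
        simp only [insertPair, Iso.trans_hom, Iso.symm_hom, whiskerLeftIso_hom]; monoidal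

end Bending

/-! ### The handle slide -/

namespace RelPreModular

variable [LinearRibbonCategory 𝕜 C] {G : Type*} [AddCommGroup G] {Z : Type*} [AddCommGroup Z]
  {X : Set G} (M : RelPreModular 𝕜 C G Z X)

/-- A natural endomorphism of the identity functor that does not see the objects `σ(k)` next to
objects of degree `0`. -/
structure TransparentTwist (M : RelPreModular 𝕜 C G Z X) where
  app : ∀ A : C, A ⟶ A
  naturality : ∀ {A B : C} (f : A ⟶ B), f ≫ app B = app A ≫ f
  app_tensor : ∀ {A : C} (k : Z), M.grading.deg 0 A → app (A ⊗ M.σ.obj k) = app A ▷ M.σ.obj k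

section Pairing

variable {W L Y κ ν : C} (s : W ⊗ L ⟶ Y ⊗ κ) (a : Wᘁ ⊗ Y ⟶ L ⊗ ν)
  (j₀ : 𝟙_ C ≅ κ ⊗ ν) (j₁ : ν ⊗ κ ≅ 𝟙_ C)

/-- The composition `L ⟶ L ⊗ ν ⊗ κ` of a bent morphism with another morphism. -/
def bendComp {W L L' Y κ ν : C} (s : W ⊗ L ⟶ Y ⊗ κ) (a : Wᘁ ⊗ Y ⟶ L' ⊗ ν) : L ⟶ (L' ⊗ ν) ⊗ κ :=
  bendLeft s ≫ (α_ _ _ _).inv ≫ a ▷ κ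

/-- The composition `Y ⟶ Y ⊗ κ ⊗ ν` of a bent morphism with another morphism. -/
def cupComp {W L Y Y' κ ν : C} (s : W ⊗ L ⟶ Y' ⊗ κ) (a : Wᘁ ⊗ Y ⟶ L ⊗ ν) : Y ⟶ (Y' ⊗ κ) ⊗ ν :=
  cupLeft W Y ≫ W ◁ a ≫ (α_ _ _ _).inv ≫ s ▷ ν

/-- By the zigzag identity, the left side is the trace of a composite ending in `s`. Rotating `s` to
the front and closing `W` on the left gives the right side. -/
lemma T_pairing (h : j₀.hom ▷ κ ≫ (α_ _ _ _).hom ≫ κ ◁ j₁.hom = (λ_ _).hom ≫ (ρ_ _).inv)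
    (t : MTrace 𝕜 (projIdeal C)) [ProjObj L] [ProjObj Y] :
    t.T (Y ⊗ κ) ((cupComp s a ≫ (insertPair j₀ Y).inv) ▷ κ) =
      t.T L (bendComp s a ≫ (insertPair j₁.symm L).inv) := by
  have hz : (insertPair j₀ Y).inv ▷ κ = (insertPair j₁.symm (Y ⊗ κ)).inv := by
    rw [← cancel_epi (insertPair j₁.symm (Y ⊗ κ)).hom, Iso.hom_inv_id,
      ← insertPair_zigzag j₀ j₁ h, ← comp_whiskerRight, Iso.hom_inv_id, id_whiskerRight]
  have hn : s ▷ ν ▷ κ ≫ (insertPair j₁.symm (Y ⊗ κ)).inv =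
      (insertPair j₁.symm (W ⊗ L)).inv ≫ s := by
    rw [Iso.comp_inv_eq, Category.assoc, insertPair_naturality, Iso.inv_hom_id_assoc]
  have h1 : (cupComp s a ≫ (insertPair j₀ Y).inv) ▷ κ =
      (cupLeft W (Y ⊗ κ) ≫ W ◁ ((α_ _ _ _).inv ≫ a ▷ κ ≫ (insertPair j₁.symm L).inv)) ≫ s := by
    simp only [comp_whiskerRight, hz, cupComp, Category.assoc, hn]
    simp only [cupLeft, insertPair, Iso.trans_inv, Iso.symm_inv, whiskerLeftIso_inv]
    monoidal
  rw [h1, t.T_cyclic, t.T_ptrLeft, ptrLeft_comp_cupLeft]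
  simp only [bendComp, Category.assoc]

end Pairing

variable {M} (ϑ : M.TransparentTwist)

/-- Tensoring with `σ(k)` costs only its sign, because `ϑ` ignores `σ(k)` beside the degree-zero
object `V ⊗ Y`; the zigzag identity then moves the inserted pair from `Y` to `L`. -/
lemma T_transport {V W L Y : C} {k : Z} {ν : C} (hVY : M.grading.deg 0 (V ⊗ Y)) [ProjObj V]
    (j₀ : 𝟙_ C ≅ M.σ.obj k ⊗ ν) (j₁ : ν ⊗ M.σ.obj k ≅ 𝟙_ C)
    (h : j₀.hom ▷ M.σ.obj k ≫ (α_ _ _ _).hom ≫ M.σ.obj k ◁ j₁.hom = (λ_ _).hom ≫ (ρ_ _).inv)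
    (x : V ⊗ W ⟶ V ⊗ W) (ι : Y ⊗ M.σ.obj k ⟶ W ⊗ L) (b : L ⊗ ν ⟶ Wᘁ ⊗ Y) :
    M.σ.sign k * M.t.T (V ⊗ Y) (V ◁ ((insertPair j₀ Y).hom ≫ ι ▷ ν ≫ (α_ _ _ _).hom) ≫
      extend x (L ⊗ ν) ≫ V ◁ (W ◁ b ≫ capLeft W Y) ≫ ϑ.app (V ⊗ Y)) =
    M.t.T (V ⊗ (Y ⊗ M.σ.obj k)) (V ◁ ι ≫ extend x L ≫
      V ◁ (W ◁ ((insertPair j₁.symm L).hom ≫ b ▷ M.σ.obj k ≫ (α_ _ _ _).hom) ≫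
        capLeft W (Y ⊗ M.σ.obj k)) ≫ ϑ.app (V ⊗ (Y ⊗ M.σ.obj k))) := by
  have hϑ : ϑ.app (V ⊗ (Y ⊗ (M.σ.obj k))) =
      (α_ _ _ _).inv ≫ ϑ.app (V ⊗ Y) ▷ (M.σ.obj k) ≫ (α_ _ _ _).hom := by
    rw [← ϑ.app_tensor k hVY, ← ϑ.naturality, Iso.inv_hom_id_assoc]
  rw [← M.σ.T_whiskerRight, ← M.t.T_conj (α_ V Y (M.σ.obj k))]
  congr 1
  have h1 : (insertPair j₀ Y).hom ▷ (M.σ.obj k) ≫ ι ▷ ν ▷ (M.σ.obj k) ≫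
      (α_ W L ν).hom ▷ (M.σ.obj k) =
      ι ≫ W ◁ (insertPair j₁.symm L).hom ≫ (α_ W (L ⊗ ν) (M.σ.obj k)).inv := by
    rw [insertPair_zigzag j₀ j₁ h, ← reassoc_of% (insertPair_naturality j₁.symm ι),
      insertPair_tensor]
  have h2 := extend_naturality x (insertPair j₁.symm L).hom
  have h3 := extend_tensor x (L ⊗ ν) (M.σ.obj k)
  rw [h3] at h2
  calc _ = V ◁ ((insertPair j₀ Y).hom ▷ (M.σ.obj k) ≫ ι ▷ ν ▷ (M.σ.obj k) ≫
        (α_ W L ν).hom ▷ (M.σ.obj k)) ≫ (α_ _ _ _).inv ≫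
        extend x (L ⊗ ν) ▷ (M.σ.obj k) ≫ (α_ _ _ _).hom ≫ V ◁ (W ◁ b ≫ capLeft W Y) ▷ (M.σ.obj k) ≫
          (α_ _ _ _).inv ≫ ϑ.app (V ⊗ Y) ▷ (M.σ.obj k) ≫ (α_ _ _ _).hom := by monoidal
    _ = V ◁ ι ≫ (V ◁ W ◁ (insertPair j₁.symm L).hom ≫ V ◁ (α_ W (L ⊗ ν) (M.σ.obj k)).inv ≫
        (α_ _ _ _).inv ≫
        extend x (L ⊗ ν) ▷ (M.σ.obj k) ≫ (α_ _ _ _).hom ≫ V ◁ (α_ W (L ⊗ ν) (M.σ.obj k)).hom) ≫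
          V ◁ (α_ W (L ⊗ ν) (M.σ.obj k)).inv ≫ V ◁ (W ◁ b ≫ capLeft W Y) ▷ (M.σ.obj k) ≫
          (α_ _ _ _).inv ≫ ϑ.app (V ⊗ Y) ▷ (M.σ.obj k) ≫ (α_ _ _ _).hom := by rw [h1]; simp
    _ = _ := by
      rw [h2, hϑ]
      simp only [Category.assoc, capLeft]
      monoidal

section Slide

variable {g g' h : G} {V W : C}

/-- Up to powers of `σ`, there are no morphisms between different duals. -/
lemma dual_hom_tensor_eq_zero (M : RelPreModular 𝕜 C G Z X) (hg : g ∉ X) {i j : Fin (M.card g)}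
    {k l : Z} (h : ¬ (i = j ∧ k + l = 0))
    (f : (M.V g i)ᘁ ⟶ ((M.V g j)ᘁ ⊗ M.σ.obj k) ⊗ M.σ.obj l) : f = 0 := by
  obtain ⟨e⟩ := M.σ.add_iso k l
  have := M.dual_hom_eq_zero hg h e (f ≫ (α_ _ _ _).hom)
  rw [← cancel_mono (α_ _ _ _).hom, this]
  simp

lemma dual_exists_scalar_iso (M : RelPreModular 𝕜 C G Z X) (hg : g ∉ X) (i : Fin (M.card g))
    {B : C} (e : (M.V g i)ᘁ ≅ B) (f : (M.V g i)ᘁ ⟶ B) : ∃ c : 𝕜, f = c • e.hom := by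
  obtain ⟨c, hc⟩ := M.dual_exists_scalar hg i (f ≫ e.inv)
  refine ⟨c, ?_⟩
  rw [← cancel_mono e.inv, hc]
  simp

/-- Both composites `bendComp s a` and `cupComp s a` are scalars up to an inserted pair. `T_pairing`
relates the scalars, `T_transport` the remaining diagrams. -/
lemma pairing_term (hg : g ∉ X) (hg' : g' ∉ X) (hV : M.grading.deg g V) [ProjObj V]
    (x : V ⊗ W ⟶ V ⊗ W) {i : Fin (M.card g)} {k : Fin (M.card g')} {m n : Z}
    (s : W ⊗ (M.V g' k)ᘁ ⟶ (M.V g i)ᘁ ⊗ M.σ.obj m)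
    (ι : (M.V g i)ᘁ ⊗ M.σ.obj m ⟶ W ⊗ (M.V g' k)ᘁ)
    (a : Wᘁ ⊗ (M.V g i)ᘁ ⟶ (M.V g' k)ᘁ ⊗ M.σ.obj n)
    (b : (M.V g' k)ᘁ ⊗ M.σ.obj n ⟶ Wᘁ ⊗ (M.V g i)ᘁ) :
    M.d g' k * M.t.T (V ⊗ ((M.V g i)ᘁ ⊗ M.σ.obj m)) (V ◁ ι ≫ extend x ((M.V g' k)ᘁ) ≫
      V ◁ (W ◁ (bendComp s a ≫ b ▷ M.σ.obj m ≫ (α_ _ _ _).hom) ≫ capLeft W _) ≫ ϑ.app _) =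
    M.d g i * M.t.T (V ⊗ (M.V g i)ᘁ) (V ◁ (cupComp s a ≫ ι ▷ M.σ.obj n ≫ (α_ _ _ _).hom) ≫
      extend x _ ≫ V ◁ (W ◁ b ≫ capLeft W _) ≫ ϑ.app _) := by
  have hVY : M.grading.deg 0 (V ⊗ (M.V g i)ᘁ) :=
    M.deg_cast (M.grading.tensor_mem hV (M.dual_mem hg i)) (add_neg_cancel g)
  -- Unless the powers of `σ` cancel, both composites run between non-isomorphic simple objects and
  -- vanish.
  by_cases hmn : m + n = 0
  · obtain ⟨j₀, j₁, hj⟩ := M.σ.exists_zigzag hmn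
    have := M.projObj_dual hg i
    have := M.projObj_dual hg' k
    obtain ⟨c, hc⟩ := M.dual_exists_scalar_iso hg' k (insertPair j₁.symm _) (bendComp s a)
    obtain ⟨c', hc'⟩ := M.dual_exists_scalar_iso hg i (insertPair j₀ _) (cupComp s a)
    have hp := T_pairing s a j₀ j₁ hj M.t
    rw [M.σ.T_whiskerRight, hc, hc'] at hp
    simp only [Linear.smul_comp, Iso.hom_inv_id, map_smul, smul_eq_mul, M.T_dual hg,
      M.T_dual hg'] at hp
    have ht := T_transport ϑ hVY j₀ j₁ hj x ι b
    rw [hc, hc']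
    simp only [Linear.smul_comp, Linear.comp_smul, MonoidalLinear.whiskerLeft_smul, map_smul,
      smul_eq_mul] at ht ⊢
    rw [← ht]
    have h1 := M.σ.sign_mul_self m
    -- `hp` says `sign m * (c' * d(V_i)) = c * d(V_k)`; the second sign comes from the transport,
    -- and their product is `1`.
    linear_combination (-M.σ.sign m * M.t.T (V ⊗ (M.V g i)ᘁ) (V ◁ ((insertPair j₀ _).hom ≫
      ι ▷ M.σ.obj n ≫ (α_ _ _ _).hom) ≫ extend x _ ≫ V ◁ (W ◁ b ≫ capLeft W _) ≫ ϑ.app _)) * hp +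
      (c' * M.d g i * M.t.T (V ⊗ (M.V g i)ᘁ) (V ◁ ((insertPair j₀ _).hom ≫
      ι ▷ M.σ.obj n ≫ (α_ _ _ _).hom) ≫ extend x _ ≫ V ◁ (W ◁ b ≫ capLeft W _) ≫ ϑ.app _)) * h1
  · rw [M.dual_hom_tensor_eq_zero hg' (fun h => hmn (by rw [add_comm]; exact h.2)) (bendComp s a),
      M.dual_hom_tensor_eq_zero hg (fun h => hmn h.2) (cupComp s a)]
    simp

lemma eq_sum_bendComp (hg' : g' ∉ X) {k : Fin (M.card g')} {Y : C} {m : Z}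
    (s : W ⊗ (M.V g' k)ᘁ ⟶ Y ⊗ M.σ.obj m) {n : Fin (M.card g') → Type} [∀ l, Fintype (n l)]
    {q : ∀ l, n l → Z} (a : ∀ l (β : n l), Wᘁ ⊗ Y ⟶ (M.V g' l)ᘁ ⊗ M.σ.obj (q l β))
    (b : ∀ l (β : n l), (M.V g' l)ᘁ ⊗ M.σ.obj (q l β) ⟶ Wᘁ ⊗ Y)
    (hab : 𝟙 _ = ∑ l, ∑ β, a l β ≫ b l β) :
    s = ∑ β, W ◁ (bendComp s (a k β) ≫ b k β ▷ M.σ.obj m ≫ (α_ _ _ _).hom) ≫ capLeft W _ := by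
  have h1 : bendLeft s = ∑ l, ∑ β, bendComp s (a l β) ≫ b l β ▷ M.σ.obj m ≫ (α_ _ _ _).hom := by
    have h2 : bendLeft s = bendLeft s ≫ (α_ _ _ _).inv ≫ (𝟙 (Wᘁ ⊗ Y)) ▷ M.σ.obj m ≫
        (α_ _ _ _).hom := by simp
    rw [h2, hab]
    simp [bendComp, Preadditive.sum_comp, Preadditive.comp_sum, sum_whiskerRight]
  rw [Finset.sum_eq_single k] at h1
  · conv_lhs => rw [← bendLeft_capLeft s, h1]
    simp [Preadditive.sum_comp, whiskerLeft_sum]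
  · intro l _ hl
    refine Finset.sum_eq_zero fun β _ => ?_
    rw [M.dual_hom_tensor_eq_zero hg' (fun h => hl h.1.symm) (bendComp s (a l β))]
    simp
  · simp

lemma eq_sum_cupComp (hg : g ∉ X) {i : Fin (M.card g)} {L : C} {q : Z}
    (a : Wᘁ ⊗ (M.V g i)ᘁ ⟶ L ⊗ M.σ.obj q) {n : Fin (M.card g) → Type} [∀ l, Fintype (n l)]
    {m : ∀ l, n l → Z} (s : ∀ l (β : n l), W ⊗ L ⟶ (M.V g l)ᘁ ⊗ M.σ.obj (m l β))
    (ι : ∀ l (β : n l), (M.V g l)ᘁ ⊗ M.σ.obj (m l β) ⟶ W ⊗ L)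
    (hs : 𝟙 _ = ∑ l, ∑ β, s l β ≫ ι l β) :
    cupLeft W _ ≫ W ◁ a = ∑ β, cupComp (s i β) a ≫ ι i β ▷ M.σ.obj q ≫ (α_ _ _ _).hom := by
  have h1 : cupLeft W _ ≫ W ◁ a =
      ∑ l, ∑ β, cupComp (s l β) a ≫ ι l β ▷ M.σ.obj q ≫ (α_ _ _ _).hom := by
    have h2 : cupLeft W _ ≫ W ◁ a = cupLeft W _ ≫ W ◁ a ≫ (α_ _ _ _).inv ≫
        (𝟙 (W ⊗ L)) ▷ M.σ.obj q ≫ (α_ _ _ _).hom := by simp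
    rw [h2, hs]
    simp [cupComp, Preadditive.sum_comp, Preadditive.comp_sum, sum_whiskerRight]
  rw [h1, Finset.sum_eq_single i]
  · intro l _ hl
    refine Finset.sum_eq_zero fun β _ => ?_
    rw [M.dual_hom_tensor_eq_zero hg (fun h => hl h.1.symm) (cupComp (s l β) a)]
    simp
  · simp

/-- Handle slide: a strand `W` that runs parallel to a strand `V` inside of a framed circle with a
Kirby color can be moved out of the circle. -/
theorem slide (hg : g ∉ X) (hg' : g' ∉ X) (hh : g + h = g') (hV : M.grading.deg g V)
    (hW : M.grading.deg h W) [ProjObj V] (x : V ⊗ W ⟶ V ⊗ W) :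
    ∑ k, M.d g' k * M.t.T ((V ⊗ W) ⊗ (M.V g' k)ᘁ) (x ▷ _ ≫ ϑ.app _) =
      ∑ i, M.d g i * M.t.T (V ⊗ (M.V g i)ᘁ) (ptr x ▷ _ ≫ ϑ.app _) := by
  -- Here `W ⊗ V_kᘁ` has degree `h - g' = -g`, and `Wᘁ ⊗ V_iᘁ` has degree `-h - g = -g'`, so both
  -- split over duals of generic colours, whatever `h` is.
  have hA := fun k => M.exists_decomposition hg (h := h + -g') (by rw [← hh]; abel)
    (M.grading.tensor_mem hW (M.dual_mem hg' k))
  have hB := fun i => M.exists_decomposition hg' (h := -h + -g) (by rw [← hh]; abel)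
    (M.grading.tensor_mem (M.grading.dual_mem hW) (M.dual_mem hg i))
  choose nA fA m s ι hA using hA
  choose nB fB q a b hB using hB
  have hL : ∀ k, M.t.T ((V ⊗ W) ⊗ (M.V g' k)ᘁ) (x ▷ _ ≫ ϑ.app _) = ∑ i, ∑ α : nA k i, ∑ β : nB i k,
      M.t.T (V ⊗ ((M.V g i)ᘁ ⊗ M.σ.obj (m k i α))) (V ◁ ι k i α ≫ extend x ((M.V g' k)ᘁ) ≫
        V ◁ (W ◁ (bendComp (s k i α) (a i k β) ≫ b i k β ▷ M.σ.obj (m k i α) ≫ (α_ _ _ _).hom) ≫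
          capLeft W _) ≫ ϑ.app _) := by
    intro k
    have h1 : M.t.T ((V ⊗ W) ⊗ (M.V g' k)ᘁ) (x ▷ _ ≫ ϑ.app _) =
        M.t.T (V ⊗ (W ⊗ (M.V g' k)ᘁ)) (V ◁ 𝟙 _ ≫ extend x _ ≫ ϑ.app _) := by
      rw [← M.t.T_conj (α_ _ _ _), Category.assoc, ← ϑ.naturality]
      simp [extend]
    rw [h1, hA k]
    simp only [whiskerLeft_sum, Preadditive.sum_comp, map_sum]
    refine Finset.sum_congr rfl fun i _ => Finset.sum_congr rfl fun α _ => ?_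
    rw [MonoidalCategory.whiskerLeft_comp, Category.assoc, M.t.T_cyclic]
    simp only [Category.assoc, ← ϑ.naturality]
    conv_lhs => rw [eq_sum_bendComp hg' (s k i α) (a i) (b i) (hB i)]
    simp only [whiskerLeft_sum, Preadditive.sum_comp, Preadditive.comp_sum, map_sum]
  have hR : ∀ i, M.t.T (V ⊗ (M.V g i)ᘁ) (ptr x ▷ _ ≫ ϑ.app _) = ∑ k, ∑ β : nB i k, ∑ α : nA k i,
      M.t.T (V ⊗ (M.V g i)ᘁ) (V ◁ (cupComp (s k i α) (a i k β) ≫ ι k i α ▷ M.σ.obj (q i k β) ≫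
        (α_ _ _ _).hom) ≫ extend x _ ≫ V ◁ (W ◁ b i k β ≫ capLeft W _) ≫ ϑ.app _) := by
    intro i
    have h1 : ptr x ▷ (M.V g i)ᘁ = V ◁ cupLeft W _ ≫ V ◁ W ◁ 𝟙 _ ≫ extend x _ ≫
        V ◁ capLeft W _ := by
      rw [ptr_whiskerRight]; simp
    rw [h1, hB i]
    simp only [whiskerLeft_sum, Preadditive.sum_comp, Preadditive.comp_sum, map_sum]
    refine Finset.sum_congr rfl fun k _ => Finset.sum_congr rfl fun β _ => ?_
    have h2 : V ◁ cupLeft W ((M.V g i)ᘁ) ≫ V ◁ W ◁ (a i k β ≫ b i k β) ≫ extend x _ ≫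
        V ◁ capLeft W _ = V ◁ (cupLeft W _ ≫ W ◁ a i k β) ≫ extend x _ ≫
          V ◁ (W ◁ b i k β ≫ capLeft W _) := by
      simp only [MonoidalCategory.whiskerLeft_comp, Category.assoc]
      rw [reassoc_of% (extend_naturality x (b i k β))]
    rw [← map_sum]
    congr 1
    rw [h2, eq_sum_cupComp hg (a i k β) (s k) (ι k) (hA k)]
    simp only [whiskerLeft_sum, Preadditive.sum_comp, Category.assoc]
  simp only [hL, hR, Finset.mul_sum]
  rw [Finset.sum_comm]
  refine Finset.sum_congr rfl fun i _ => Finset.sum_congr rfl fun k _ => ?_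
  rw [Finset.sum_comm]
  exact Finset.sum_congr rfl fun β _ => Finset.sum_congr rfl fun α _ =>
    pairing_term ϑ hg hg' hV x _ _ _ _

end Slide

/-! ### Kirby-coloured loops are scalars -/

section KirbyLoop

/-- The strand `A` in a circle with the Kirby color `Ω_g`, framed by means of `ϑ`. -/
noncomputable def kirbyLoop (g : G) (A : C) : A ⟶ A :=
  M.kirby g fun U => ptr (ϑ.app (A ⊗ Uᘁ))

lemma kirbyLoop_naturality (g : G) {A B : C} (f : A ⟶ B) :
    f ≫ kirbyLoop ϑ g B = kirbyLoop ϑ g A ≫ f := by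
  simp only [kirbyLoop, kirby, Preadditive.comp_sum, Preadditive.sum_comp, Linear.comp_smul,
    Linear.smul_comp]
  exact Finset.sum_congr rfl fun i _ => by
    rw [ptr_naturality f (ϑ.app (A ⊗ _)) (ϑ.app (B ⊗ _)) (ϑ.naturality _)]

lemma T_kirbyLoop (g : G) {A : C} [ProjObj A] (x : A ⟶ A) :
    M.t.T A (x ≫ kirbyLoop ϑ g A) =
      ∑ i, M.d g i * M.t.T (A ⊗ (M.V g i)ᘁ) (x ▷ _ ≫ ϑ.app _) := by
  simp only [kirbyLoop, kirby, Preadditive.comp_sum, Linear.comp_smul, map_sum, map_smul,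
    smul_eq_mul, M.t.T_ptr, ptr_whiskerRight_comp]

/-- The slide turns the trace against `z` into a trace against `ptr z` on `V`, where the loop is
`c`; the partial trace property returns `c` times the trace of `z`. -/
lemma kirbyLoop_tensor {g g' h : G} (hg : g ∉ X) (hg' : g' ∉ X) (hh : g + h = g') {V W : C}
    (hV : M.grading.deg g V) (hW : M.grading.deg h W) {c : 𝕜} (hc : kirbyLoop ϑ g V = c • 𝟙 V) :
    kirbyLoop ϑ g' (V ⊗ W) = c • 𝟙 _ := by
  have := M.projObj_of_deg hg hV
  rw [← sub_eq_zero]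
  refine M.T_nondegenerate hg' (M.deg_cast (M.grading.tensor_mem hV hW) hh) _ fun z => ?_
  rw [M.t.T_cyclic, Preadditive.comp_sub, map_sub, T_kirbyLoop, slide ϑ hg hg' hh hV hW,
    ← T_kirbyLoop, hc]
  simp only [Linear.comp_smul, Category.comp_id, map_smul, ← M.t.T_ptr, sub_self]

lemma kirbyLoop_eq {g : G} (hg : g ∉ X) (j : Fin (M.card g)) :
    ∃ c : 𝕜, ∀ g', g' ∉ X → ∀ A : C, M.grading.deg g' A → kirbyLoop ϑ g' A = c • 𝟙 A := by
  obtain ⟨c, hc⟩ := M.V_exists_scalar hg j (kirbyLoop ϑ g (M.V g j))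
  refine ⟨c, fun g' hg' A hA => ?_⟩
  -- The degree `-g + g'` of `V_jᘁ ⊗ A` may lie in `X`; the slide needs only `g` and `g'` generic.
  have h1 := kirbyLoop_tensor ϑ hg hg' (h := -g + g') (by abel) (M.V_mem g hg j)
    (M.grading.tensor_mem (M.dual_mem hg j) hA) hc
  have : Epi (evL (M.V g j)) := epi_evL (M.V_regular g hg j)
  have : Epi (evL (M.V g j) ▷ A) := epi_whiskerRight _ _
  have h2 := kirbyLoop_naturality ϑ g' ((α_ _ _ _).inv ≫ evL (M.V g j) ▷ A ≫ (λ_ A).hom)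
  rw [h1, Linear.smul_comp, Category.id_comp, ← Category.comp_id (λ_ A).hom] at h2
  rw [← cancel_epi ((α_ _ _ _).inv ≫ evL (M.V g j) ▷ A ≫ (λ_ A).hom), ← Category.comp_id (λ_ A).hom,
    h2]
  simp

end KirbyLoop

lemma exists_generic (M : RelPreModular 𝕜 C G Z X) : ∃ g, g ∉ X := by
  by_contra! h
  refine M.small {0} ?_
  ext x
  simp [h]

lemma exists_index (M : RelPreModular 𝕜 C G Z X) {g : G} (hg : g ∉ X) :
    Nonempty (Fin (M.card g)) := by
  obtain ⟨A, hA, hne⟩ := M.exists_nonzero g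
  by_contra hemp
  rw [not_nonempty_iff] at hemp
  obtain ⟨m, a, ι, s, hs⟩ := (M.dominating g hg).2 A hA
  apply hne
  rw [hs]
  exact Finset.sum_eq_zero fun k _ => isEmptyElim (a k).1

/-- Bilinearity of `ψ` forces `ψ(0, k) = 1`. -/
lemma doubleBraiding_σ (M : RelPreModular 𝕜 C G Z X) {A : C} (hA : M.grading.deg 0 A) (k : Z) :
    doubleBraiding A (M.σ.obj k) = Iso.refl _ := by
  obtain ⟨ψ, hψ⟩ := M.compatibility
  ext
  rw [hψ 0 A k hA]
  simp

/-- The twist. -/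
def twistPlus (M : RelPreModular 𝕜 C G Z X) : M.TransparentTwist where
  app A := (twist A).hom
  naturality f := twist_hom_naturality f
  app_tensor k hA := by
    rw [twist_hom_tensor, M.doubleBraiding_σ hA, M.σ.twist_eq]
    simp

/-- The inverse of the twist. -/
def twistMinus (M : RelPreModular 𝕜 C G Z X) : M.TransparentTwist where
  app A := (twist A).inv
  naturality f := twist_inv_naturality f
  app_tensor k hA := by
    have : (twist (M.σ.obj k)).inv = 𝟙 _ := by
      rw [← cancel_epi (twist _).hom, Iso.hom_inv_id, M.σ.twist_eq, Category.comp_id]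
    rw [twist_inv_tensor, M.doubleBraiding_σ hA, this]
    simp

lemma isDeltaPlus_iff {Δ : 𝕜} : M.IsDeltaPlus Δ ↔
    ∀ g, g ∉ X → ∀ W : C, M.grading.deg g W → kirbyLoop M.twistPlus g W = Δ • 𝟙 W := by
  simp only [IsDeltaPlus, kirbyLoop, kirby, loopPlus_eq, twistPlus]

lemma isDeltaMinus_iff {Δ : 𝕜} : M.IsDeltaMinus Δ ↔
    ∀ g, g ∉ X → ∀ W : C, M.grading.deg g W → kirbyLoop M.twistMinus g W = Δ • 𝟙 W := by
  simp only [IsDeltaMinus, kirbyLoop, kirby, loopMinus_eq, twistMinus]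

lemma smul_id_injective {A : C} (hA : 𝟙 A ≠ 0) {a b : 𝕜} (h : a • 𝟙 A = b • 𝟙 A) : a = b :=
  smul_left_injective 𝕜 hA h

lemma existsUnique_kirbyLoop : ∃! Δ : 𝕜,
    ∀ g, g ∉ X → ∀ W : C, M.grading.deg g W → kirbyLoop ϑ g W = Δ • 𝟙 W := by
  obtain ⟨g, hg⟩ := M.exists_generic
  obtain ⟨j⟩ := M.exists_index hg
  obtain ⟨c, hc⟩ := kirbyLoop_eq ϑ hg j
  refine ⟨c, hc, fun Δ hΔ => smul_id_injective (M.V_id_ne_zero hg j) ?_⟩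
  rw [← hc g hg _ (M.V_mem g hg j), hΔ g hg _ (M.V_mem g hg j)]

end RelPreModular

end Linear

/-! ### Exchanging meridians -/

section Exchange

variable {C : Type u} [Category.{v} C] [MonoidalCategory C] [BraidedCategory C]

/-- Move the strand `K` below the strand `U`. -/
def swapRight (W U K : C) : (W ⊗ U) ⊗ K ≅ (W ⊗ K) ⊗ U :=
  α_ W U K ≪≫ whiskerLeftIso W (β_ K U).symm ≪≫ (α_ W K U).symm

lemma swapRight_braiding (W U K : C) :
    (swapRight W U K).hom ≫ (β_ (W ⊗ K) U).hom = (β_ W U).hom ▷ K ≫ (α_ U W K).hom := by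
  rw [BraidedCategory.braiding_tensor_left_hom]
  simp [swapRight]

lemma swapRight_naturality_left {W W' : C} (f : W ⟶ W') (U K : C) :
    f ▷ U ▷ K ≫ (swapRight W' U K).hom = (swapRight W U K).hom ≫ f ▷ K ▷ U := by
  simp only [swapRight, Iso.trans_hom, whiskerLeftIso_hom, Iso.symm_hom, Category.assoc]
  rw [associator_naturality_left_assoc, ← whisker_exchange_assoc, associator_inv_naturality_left]

lemma swapRight_tensor (W U Y K : C) :
    (swapRight W (U ⊗ Y) K).hom = (α_ W U Y).inv ▷ K ≫ (swapRight (W ⊗ U) Y K).hom ≫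
      (swapRight W U K).hom ▷ Y ≫ (α_ (W ⊗ K) U Y).hom := by
  simp only [swapRight, Iso.trans_hom, whiskerLeftIso_hom, Iso.symm_hom, Category.assoc]
  rw [BraidedCategory.braiding_tensor_right_inv]
  monoidal

lemma swapRight_extend {W U : C} (z : W ⊗ U ⟶ W ⊗ U) (Y K : C) :
    (swapRight W (U ⊗ Y) K).inv ≫ extend z Y ▷ K ≫ (swapRight W (U ⊗ Y) K).hom =
      extend ((swapRight W U K).inv ≫ z ▷ K ≫ (swapRight W U K).hom) Y := by
  rw [Iso.inv_comp_eq, swapRight_tensor]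
  simp only [extend, comp_whiskerRight, Category.assoc, Iso.hom_inv_id_assoc]
  rw [← comp_whiskerRight_assoc (swapRight W U K).hom, Iso.hom_inv_id, id_whiskerRight,
    Category.id_comp, ← reassoc_of% (swapRight_naturality_left z Y K)]
  simp

variable [RightRigidCategory C] [RibbonCategory C]

/-- The closed strand `K` passes entirely on one side of `U`, so its circle slides off `U`. -/
lemma ptr_swapRight {W K : C} (U : C) (v : W ⊗ K ⟶ W ⊗ K) :
    ptr ((swapRight W U K).hom ≫ v ▷ U ≫ (swapRight W U K).inv) = ptr v ▷ U := by
  have h1 : (swapRight W U K).hom ≫ v ▷ U ≫ (swapRight W U K).inv =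
      (β_ W U).hom ▷ K ≫ ((α_ U W K).hom ≫ U ◁ v ≫ (α_ U W K).inv) ≫ (β_ W U).inv ▷ K := by
    rw [← cancel_mono ((swapRight W U K).hom ≫ (β_ (W ⊗ K) U).hom)]
    simp only [Category.assoc, Iso.inv_hom_id_assoc]
    rw [BraidedCategory.braiding_naturality_left, reassoc_of% (swapRight_braiding W U K),
      swapRight_braiding]
    simp [← comp_whiskerRight_assoc]
  have h2 := ptr_naturality (β_ W U).hom ((swapRight W U K).hom ≫ v ▷ U ≫ (swapRight W U K).inv)
    ((α_ U W K).hom ≫ U ◁ v ≫ (α_ U W K).inv) (by rw [h1]; simp [← comp_whiskerRight])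
  rw [ptr_whiskerLeft, ← BraidedCategory.braiding_naturality_left] at h2
  exact ((cancel_mono _).1 h2).symm

/-- Balancing expresses the twist of `W ⊗ U` by that of `W ⊗ U ⊗ K` and the double braiding with
`K`. The part of the latter at `U` cancels, leaving the part at `W`, again a ratio of twists up to
the framing of `K`. -/
lemma doubleBraiding_inv_twist_inv (W U K : C) :
    ((α_ W U K).hom ≫ W ◁ (doubleBraiding U K).inv ≫ (α_ W U K).inv) ≫ (twist (W ⊗ U)).inv ▷ K =
      (swapRight W U K).hom ≫ ((twist W).inv ▷ K ≫ (twist (W ⊗ K)).hom) ▷ U ≫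
        (swapRight W U K).inv ≫ (twist ((W ⊗ U) ⊗ K)).inv := by
  have h1 : (twist (W ⊗ U)).inv ▷ K = (W ⊗ U) ◁ (twist K).hom ≫ (doubleBraiding (W ⊗ U) K).hom ≫
      (twist ((W ⊗ U) ⊗ K)).inv := by
    rw [twist_inv_tensor (W ⊗ U) K]
    simp
  have h2 : (twist W).inv ▷ K ≫ (twist (W ⊗ K)).hom =
      W ◁ (twist K).hom ≫ (doubleBraiding W K).hom := by
    rw [twist_hom_tensor, MonoidalCategory.tensorHom_def]
    simp [← comp_whiskerRight_assoc]
  have h3 : (doubleBraiding (W ⊗ U) K).hom = (α_ W U K).hom ≫ W ◁ (β_ U K).hom ≫ (α_ W K U).inv ≫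
      (doubleBraiding W K).hom ▷ U ≫ (swapRight W U K).inv := by
    simp [doubleBraiding, swapRight, BraidedCategory.braiding_tensor_left_hom,
      BraidedCategory.braiding_tensor_right_hom]
  have h4 : W ◁ (β_ U K).inv ≫ W ◁ U ◁ (twist K).hom ≫ W ◁ (β_ U K).hom =
      W ◁ (twist K).hom ▷ U := by
    simp only [← MonoidalCategory.whiskerLeft_comp]
    rw [BraidedCategory.braiding_naturality_right, Iso.inv_hom_id_assoc]
  rw [h1, h2, h3]
  simp only [swapRight, doubleBraiding, Iso.trans_hom, whiskerLeftIso_hom, Iso.symm_hom,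
    Iso.trans_inv, Category.assoc, comp_whiskerRight, MonoidalCategory.whiskerLeft_comp,
    tensor_whiskerLeft, whisker_assoc, Iso.inv_hom_id_assoc, reassoc_of% h4]

/-- The diagram factors through `W`, so naturality reduces the inverse twist to that of `W`, and
cyclicity closes `V` around `z`. -/
lemma T_evL_coevR {𝕜 : Type*} [Field 𝕜] [Preadditive C] [MonoidalPreadditive C]
    [Linear 𝕜 C] [MonoidalLinear 𝕜 C]
    (t : MTrace 𝕜 (projIdeal C)) {W V : C} [ProjObj W] (z : W ⊗ V ⟶ W ⊗ V) :
    t.T (W ⊗ (V ⊗ Vᘁ)) (W ◁ (evL V ≫ coevR V) ≫ (twist _).inv ≫ extend z (Vᘁ)) =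
      t.T (W ⊗ V) ((twist W).inv ▷ V ≫ z) := by
  have h1 : W ◁ (evL V ≫ coevR V) ≫ (twist (W ⊗ (V ⊗ Vᘁ))).inv ≫ extend z (Vᘁ) =
      (W ◁ evL V ≫ (ρ_ W).hom) ≫ (twist W).inv ≫ (ρ_ W).inv ≫ W ◁ coevR V ≫ extend z (Vᘁ) := by
    have := twist_inv_naturality ((ρ_ W).inv ≫ W ◁ coevR V)
    simp only [Category.assoc] at this
    rw [← reassoc_of% this]
    simp
  rw [h1, t.T_cyclic, t.T_ptr, ptr_whiskerRight_comp]
  simp [ptr, extend]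

end Exchange

/-! ### The modularity parameter is `Δ₊Δ₋` -/

section Linear

variable {𝕜 : Type*} [Field 𝕜] {C : Type u} [Category.{v} C] [Preadditive C]
  [Linear 𝕜 C] [MonoidalCategory C] [MonoidalPreadditive C] [MonoidalLinear 𝕜 C]
  [BraidedCategory C] [RightRigidCategory C] [RibbonCategory C]

section Zeta

/-- A meridian of a tensor product with `Y` can be exchanged for one of the strand `W`. -/
lemma T_meridian (t : MTrace 𝕜 (projIdeal C)) {W U Y K : C} [ProjObj W] (z : W ⊗ U ⟶ W ⊗ U) :
    t.T (W ⊗ (U ⊗ Y)) (W ◁ ptr (doubleBraiding (U ⊗ Y) K).inv ≫ (twist _).inv ≫ extend z Y) =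
      t.T (((W ⊗ K) ⊗ U) ⊗ Y) (((swapRight W U K).inv ≫ z ▷ K ≫ (swapRight W U K).hom ≫
        ((twist W).inv ▷ K ≫ (twist (W ⊗ K)).hom) ▷ U) ▷ Y ≫ (twist _).inv) := by
  have h1 : ((α_ _ _ _).hom ≫ W ◁ (doubleBraiding (U ⊗ Y) K).inv ≫ (α_ _ _ _).inv) ≫
      ((twist _).inv ≫ extend z Y) ▷ K = (swapRight W (U ⊗ Y) K).hom ≫
        (((twist W).inv ▷ K ≫ (twist (W ⊗ K)).hom) ▷ (U ⊗ Y) ≫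
          (swapRight W (U ⊗ Y) K).inv ≫ (twist _).inv ≫ extend z Y ▷ K) := by
    have := doubleBraiding_inv_twist_inv W (U ⊗ Y) K
    simp only [Category.assoc] at this ⊢
    rw [comp_whiskerRight, reassoc_of% this]
  rw [← ptr_whiskerLeft, ← ptr_comp_whiskerRight, ← t.T_ptr, h1, t.T_cyclic]
  have h2 : (swapRight W (U ⊗ Y) K).inv ≫ (twist _).inv ≫ extend z Y ▷ K ≫
      (swapRight W (U ⊗ Y) K).hom = (twist _).inv ≫
        extend ((swapRight W U K).inv ≫ z ▷ K ≫ (swapRight W U K).hom) Y := by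
    rw [reassoc_of% (twist_inv_naturality (swapRight W (U ⊗ Y) K).inv), swapRight_extend]
  simp only [Category.assoc, h2]
  rw [t.T_cyclic, Category.assoc, ← twist_inv_naturality, ← t.T_conj (α_ (W ⊗ K) U Y)]
  simp only [Category.assoc]
  rw [← twist_inv_naturality]
  simp [extend]

variable [LinearRibbonCategory 𝕜 C] {G : Type*} [AddCommGroup G] {Z : Type*} [AddCommGroup Z]
  {X : Set G}

namespace RelPreModular

lemma exists_generic_pair (M : RelPreModular 𝕜 C G Z X) : ∃ g h, g ∉ X ∧ h ∉ X ∧ h + g ∉ X := by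
  classical
  obtain ⟨g, hg⟩ := M.exists_generic
  by_contra! H
  -- If `h + g ∈ X` for every generic `h`, then `X` and `-g + X` cover the group.
  refine M.small {0, -g} (Set.eq_univ_of_forall fun h => ?_)
  by_cases hh : h ∈ X
  · simp [hh]
  · simpa using Or.inr (by simpa [add_comm] using H g h hg hh)

lemma sum_T_modMor_eq (M : RelPreModular 𝕜 C G Z X) {ζ : 𝕜} (hζ : M.IsModularityParameter ζ)
    {g h : G} (hg : g ∉ X) (hh : h ∉ X) (i : Fin (M.card g)) {W : C} [ProjObj W]
    (z : W ⊗ M.V g i ⟶ W ⊗ M.V g i) :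
    ∑ j, M.d g j * M.t.T (W ⊗ (M.V g i ⊗ (M.V g j)ᘁ))
      (W ◁ M.modMor g h i j ≫ (twist _).inv ≫ extend z _) =
      M.d g i * (ζ * M.t.T (W ⊗ M.V g i) ((twist W).inv ▷ _ ≫ z)) := by
  rw [Finset.sum_eq_single i]
  · rw [(hζ.2 g hg h hh).1 i, MonoidalLinear.whiskerLeft_smul, Linear.smul_comp, map_smul,
      T_evL_coevR, smul_eq_mul]
  · intro j _ hj
    simp [(hζ.2 g hg h hh).2 i j hj.symm]
  · simp

lemma sum_T_modMor_eq' (M : RelPreModular 𝕜 C G Z X) {Δp Δm : 𝕜} (hp : M.IsDeltaPlus Δp)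
    (hm : M.IsDeltaMinus Δm) {g h : G} (hg : g ∉ X) (hh : h ∉ X) (i : Fin (M.card g)) {W : C}
    (hW : M.grading.deg h W) [ProjObj W] (z : W ⊗ M.V g i ⟶ W ⊗ M.V g i) :
    ∑ j, M.d g j * M.t.T (W ⊗ (M.V g i ⊗ (M.V g j)ᘁ))
      (W ◁ M.modMor g h i j ≫ (twist _).inv ≫ extend z _) =
      M.d g i * (Δp * Δm * M.t.T (W ⊗ M.V g i) ((twist W).inv ▷ _ ≫ z)) := by
  rw [isDeltaPlus_iff] at hp
  rw [isDeltaMinus_iff] at hm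
  have h1 : ∀ k, ∑ j, M.d g j * M.t.T (W ⊗ (M.V g i ⊗ (M.V g j)ᘁ))
      (W ◁ Phi (M.V h k) (M.V g i ⊗ (M.V g j)ᘁ) ≫ (twist _).inv ≫ extend z _) =
      Δm * M.t.T (W ⊗ M.V g i) (ptr (twist (W ⊗ (M.V h k)ᘁ)).hom ▷ M.V g i ≫
        (twist W).inv ▷ M.V g i ≫ z) := by
    intro k
    -- The object `(W ⊗ V_kᘁ) ⊗ V_i` has degree `h - h + g = g`, so the sum over `j ∈ I_g` is a
    -- Kirby loop with value `Δm`.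
    have h2 := T_kirbyLoop M.twistMinus g (A := (W ⊗ (M.V h k)ᘁ) ⊗ M.V g i)
      ((swapRight W (M.V g i) _).inv ≫ z ▷ _ ≫ (swapRight W (M.V g i) _).hom ≫
        ((twist W).inv ▷ _ ≫ (twist (W ⊗ (M.V h k)ᘁ)).hom) ▷ M.V g i)
    rw [hm g hg _ (M.deg_cast (M.grading.tensor_mem (M.grading.tensor_mem hW (M.dual_mem hh k))
      (M.V_mem g hg i)) (by abel)), Linear.comp_smul, Category.comp_id, map_smul, smul_eq_mul] at h2
    simp only [Phi_eq, T_meridian]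
    refine h2.symm.trans ?_
    rw [M.t.T_cyclic]
    simp only [Category.assoc]
    rw [M.t.T_ptr, ptr_whiskerRight_comp, ptr_swapRight, ptr_whiskerRight_comp,
      ← twist_inv_naturality, comp_whiskerRight, M.t.T_cyclic, Category.assoc]
  -- `W` has degree `h` so that the colours `k ∈ I_h` of the remaining circle match it.
  have h3 : ∑ k, M.d h k • ptr (twist (W ⊗ (M.V h k)ᘁ)).hom = Δp • 𝟙 W := hp h hh W hW
  have h4 : ∀ j, M.t.T (W ⊗ (M.V g i ⊗ (M.V g j)ᘁ))
      (W ◁ M.modMor g h i j ≫ (twist _).inv ≫ extend z _) = M.d g i * ∑ k, M.d h k *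
        M.t.T (W ⊗ (M.V g i ⊗ (M.V g j)ᘁ)) (W ◁ Phi (M.V h k) (M.V g i ⊗ (M.V g j)ᘁ) ≫
          (twist _).inv ≫ extend z _) := by
    intro j
    simp only [modMor, kirby, MonoidalLinear.whiskerLeft_smul, whiskerLeft_sum, Linear.smul_comp,
      Preadditive.sum_comp, map_smul, map_sum, smul_eq_mul]
  calc _ = M.d g i * ∑ k, M.d h k * ∑ j, M.d g j * M.t.T (W ⊗ (M.V g i ⊗ (M.V g j)ᘁ))
        (W ◁ Phi (M.V h k) (M.V g i ⊗ (M.V g j)ᘁ) ≫ (twist _).inv ≫ extend z _) := by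
          simp only [h4, Finset.mul_sum]
          rw [Finset.sum_comm]
          exact Finset.sum_congr rfl fun k _ => Finset.sum_congr rfl fun j _ => by ring
    _ = M.d g i * (Δm * M.t.T (W ⊗ M.V g i) ((∑ k, M.d h k • ptr (twist (W ⊗ (M.V h k)ᘁ)).hom) ▷
          M.V g i ≫ (twist W).inv ▷ M.V g i ≫ z)) := by
          simp only [h1, sum_whiskerRight, MonoidalLinear.smul_whiskerRight, Preadditive.sum_comp,
            Linear.smul_comp, map_sum, map_smul, smul_eq_mul, Finset.mul_sum]
          exact Finset.sum_congr rfl fun k _ => by ring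
    _ = _ := by
          rw [h3, MonoidalLinear.smul_whiskerRight, id_whiskerRight, Linear.smul_comp, map_smul,
            Category.id_comp, smul_eq_mul]
          ring

lemma id_tensor_ne_zero (M : RelPreModular 𝕜 C G Z X) {W : C} (hW : 𝟙 W ≠ 0) {g : G} (hg : g ∉ X)
    (i : Fin (M.card g)) : 𝟙 (W ⊗ M.V g i) ≠ 0 := by
  intro h0
  have : Epi (evL (M.V g i)) := epi_evL (M.V_regular g hg i)
  have := epi_whiskerLeft W (evL (M.V g i))
  apply hW
  rw [← cancel_epi ((α_ _ _ _).hom ≫ W ◁ evL (M.V g i) ≫ (ρ_ W).hom), Limits.comp_zero,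
    Category.comp_id, ← Category.id_comp ((α_ _ _ _).hom ≫ _), ← id_whiskerRight, h0]
  simp

lemma IsModularityParameter.eq_mul {M : RelPreModular 𝕜 C G Z X} {ζ Δp Δm : 𝕜}
    (hζ : M.IsModularityParameter ζ) (hp : M.IsDeltaPlus Δp) (hm : M.IsDeltaMinus Δm) :
    ζ = Δp * Δm := by
  obtain ⟨g, h, hg, hh, hgh⟩ := M.exists_generic_pair
  obtain ⟨i⟩ := M.exists_index hg
  obtain ⟨l⟩ := M.exists_index hh
  have := M.projObj_V hh l
  have hdeg := M.grading.tensor_mem (M.V_mem h hh l) (M.V_mem g hg i)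
  -- The trace form on `V_l ⊗ V_i` is nondegenerate because `h + g` is generic, and an invertible
  -- twist on a nonzero object is nonzero.
  have hne : ∃ z, M.t.T (M.V h l ⊗ M.V g i) ((twist (M.V h l)).inv ▷ _ ≫ z) ≠ 0 := by
    by_contra! H
    have h1 : (twist (M.V h l)).inv ▷ M.V g i = 0 := M.T_nondegenerate hgh hdeg _ H
    apply M.id_tensor_ne_zero (M.V_id_ne_zero hh l) hg i
    rw [← id_whiskerRight, ← (twist (M.V h l)).inv_hom_id, comp_whiskerRight, h1, Limits.zero_comp]
  obtain ⟨z, hz⟩ := hne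
  have h1 := (sum_T_modMor_eq M hζ hg hh i z).symm.trans
    (sum_T_modMor_eq' M hp hm hg hh i (M.V_mem h hh l) z)
  exact mul_right_cancel₀ hz (mul_left_cancel₀ (M.d_ne_zero hg i) h1)

end RelPreModular

end Zeta

end Linear

end RelMod

theorem corollary4p5 {𝕜 : Type*} [Field 𝕜] {C : Type*} [Category* C] [Preadditive C]
    [Linear 𝕜 C] [MonoidalCategory C] [MonoidalPreadditive C] [MonoidalLinear 𝕜 C]
    [BraidedCategory C] [RightRigidCategory C] [RelMod.RibbonCategory C]
    [RelMod.LinearRibbonCategory 𝕜 C]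
    {G : Type*} [AddCommGroup G] {Z : Type*} [AddCommGroup Z] {X : Set G}
    (M : RelMod.RelPreModular 𝕜 C G Z X) (ζ : 𝕜) (hζ : M.IsModularityParameter ζ) :
    (∃! Δp : 𝕜, M.IsDeltaPlus Δp) ∧ (∃! Δm : 𝕜, M.IsDeltaMinus Δm) ∧
      ∀ Δp Δm : 𝕜, M.IsDeltaPlus Δp → M.IsDeltaMinus Δm → ζ = Δp * Δm := by
  refine ⟨?_, ?_, fun _ _ => hζ.eq_mul⟩
  · simpa only [RelMod.RelPreModular.isDeltaPlus_iff] using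
      RelMod.RelPreModular.existsUnique_kirbyLoop M.twistPlus
  · simpa only [RelMod.RelPreModular.isDeltaMinus_iff] using
      RelMod.RelPreModular.existsUnique_kirbyLoop M.twistMinus
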